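/- Let $t=(t^{(1)},t^{(2)})$, $t^{(a)}=(t^{(a)}_1,t^{(a)}_2,\dots)$, and let $\tau_{\bm m}=\tau_{\bm m}(t)$, $\bm m=(m_1,m_2)\in\mathbb Z^2$, be nonzero formal power series in $t$ over $\mathbb C$. Write $\bm e_1=(1,0)$, $\bm e_2=(0,1)$, $\bm e=(1,1)$, $\xi(x,z)=\sum_{k\ge1}x_kz^k$, $[z]=(z,z^2/2,z^3/3,\dots)$, $[z]_1=([z],0)$, $[z]_2=(0,[z])$, and let $\mathrm{Res}_z$ be the coefficient of $z^{-1}$. Assume that for all $\bm m,\bm m'\in\mathbb Z^2$ with $m_1-m_2\ge m_1'-m_2'$, and for independent $t,t'$, the two-component discrete KP bilinear equation holds: $$\mathrm{Res}_z\, z^{m_1-m_1'}e^{\xi(t^{(1)}-t^{(1)\prime},z)}\tau_{\bm m}(t-[z^{-1}]_1)\,\tau_{\bm m'}(t'+[z^{-1}]_1)=\mathrm{Res}_z\, z^{m_2-m_2'}e^{\xi(t^{(2)}-t^{(2)\prime},z^{-1})}\tau_{\bm m+\bm e}(t-[z]_2)\,\tau_{\bm m'-\bm e}(t'+[z]_2).$$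 Let $\mathcal B$ be the ring of functions of $\bm m\in\mathbb Z^2$ with values in the fraction field of $\mathbb C[[t]]$, with the partial derivatives extended to fractions; let $\Lambda_a$ be the shift $f(\bm m)\mapsto f(\bm m+\bm e_a)$, and consider operators $\sum a_{j_1j_2}(\bm m)\Lambda_1^{j_1}\Lambda_2^{j_2}$, multiplied by $\Lambda_a\cdot f(\bm m)=f(\bm m+\bm e_a)\cdot\Lambda_a$; derivatives of operators and shifts $\bm m\mapsto\bm m+\bm e$ act on the coefficients. Put $\Delta_2=\Lambda_2-1$, $\Delta_2^*=\Lambda_2^{-1}-1$, $\Delta_2^{*-1}=\sum_{j\ge1}\Lambda_2^j$, and $$\mathcal E_{(1)}=\mathcal B[\Lambda_2,\Lambda_2^{-1}]((\Lambda_1^{-1})),\quad \mathcal E_{(1)}^0=\mathcal B((\Lambda_1^{-1})),\quad \mathcal E_{(2)}=\mathcal B[\Lambda_1,\Lambda_1^{-1}]((\Lambda_2)),\quad \mathcal E_{(2)}^0=\mathcal B((\Lambda_2)).$$ Define $S_1=\sum_{k\ge0}a^{(1)}_k(\bm m,t)\Lambda_1^{-k}$ and $S_2=\sum_{k\ge0}a^{(2)}_k(\bm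 m,t)\Lambda_2^{k}$ by $$\sum_{k\ge0}a_k^{(1)}z^{-k}=\frac{\tau_{\bm m}(t-[z^{-1}]_1)}{\tau_{\bm m}(t)},\qquad \sum_{k\ge0}a_k^{(2)}z^{k}=\frac{\tau_{\bm m+\bm e}(t-[z]_2)}{\tau_{\bm m}(t)},$$ and $$\rho(\bm m)=\frac{\tau_{\bm m}\,\tau_{\bm m+\bm e+\bm e_1}}{\tau_{\bm m+\bm e_1}\,\tau_{\bm m+\bm e}},\qquad H=\Lambda_1\Delta_2+\rho .$$ Then: 1. $S_a$ has a two-sided inverse in $\mathcal E^0_{(a)}$ ($a=1,2$), and $\mathcal E_{(b)}=\mathcal E^0_{(b)}\oplus\mathcal E_{(b)}H$ in the sense that for every $A\in\mathcal E_{(b)}$ there is a unique $\pi_b(A)\in\mathcal E^0_{(b)}$ with $A-\pi_b(A)\in\mathcal E_{(b)}H$ ($b=1,2$). 2. Let $L_1=S_1\Lambda_1S_1^{-1}$, $L_2=S_2\Lambda_2^{-1}S_2^{-1}$ and, for $k\ge1$, $B^{(1)}_k=(L_1^k)_{1,\ge0}$, the part with nonnegative powers of $\Lambda_1$, and $B^{(2)}_k=(L_2^k)_{\Delta_2^*,\ge1}$,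 the part $\sum_{j\ge1}b_j\Delta_2^{*j}$ of the expansion $L_2^k=\sum_{j\le k}b_j\Delta_2^{*j}$ obtained from $\Lambda_2^{i}=(\Delta_2^*+1)^{-i}=\sum_{l\ge0}\binom{-i}{l}\Delta_2^{*(-i-l)}$. Then for all $a,b\in\{1,2\}$ and $k\ge1$, $B^{(a)}_k\in\mathcal E_{(b)}$ and $$\partial_{t^{(a)}_k}L_b=[\pi_b(B^{(a)}_k),L_b].$$ 3. $H(\bm m)L_1(\bm m)=L_1(\bm m+\bm e)H(\bm m)$ and $H(\bm m)L_2(\bm m)=\Delta_2^*\,L_2(\bm m+\bm e)\,\Delta_2^{*-1}H(\bm m)$. 4. For $a\in\{1,2\}$ and $k\ge1$, $\partial_{t^{(a)}_k}H(\bm m)=C^{(a)}_k(\bm m)H(\bm m)-H(\bm m)B^{(a)}_k(\bm m)$, where $C^{(1)}_k(\bm m)=B^{(1)}_k(\bm m+\bm e)$ and $C^{(2)}_k(\bm m)=\Delta_2^*\,B^{(2)}_k(\bm m+\bm e)\,\Delta_2^{*-1}$. -/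

import Mathlib

noncomputable section

namespace TwoDKP

/-! ## Functions of the times -/

/-- The time variables: `(a, k)` stands for `t_k^{(a+1)}` (so `a = 0, 1` are the two components). -/
abbrev Time : Type := Fin 2 × ℕ+

/-- Formal power series in all the times, over `ℂ`. -/
abbrev TimeSeries : Type := MvPowerSeries Time ℂ

/-- The field of fractions of the domain of formal power series in the times. -/
abbrev TimeField : Type := FractionRing TimeSeries

/-- The partial derivative with respect to a time, extended to fractions by the quotient rule. -/
def fracDeriv (s : Time) (x : TimeField) : TimeField :=
  let f : TimeSeries := (IsLocalization.sec (nonZeroDivisors TimeSeries) x).1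
  let g : TimeSeries := ((IsLocalization.sec (nonZeroDivisors TimeSeries) x).2 : TimeSeries)
  algebraMap TimeSeries TimeField
      (MvPowerSeries.pderiv ℂ s f * g - f * MvPowerSeries.pderiv ℂ s g) /
    algebraMap TimeSeries TimeField (g ^ 2)

/-- The quotient rule, for every representation as a fraction. -/
theorem fracDeriv_div (s : Time) (f g : TimeSeries) (hg : g ≠ 0) :
    fracDeriv s (algebraMap TimeSeries TimeField f / algebraMap TimeSeries TimeField g) =
      algebraMap TimeSeries TimeField
          (MvPowerSeries.pderiv ℂ s f * g - f * MvPowerSeries.pderiv ℂ s g) /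
        algebraMap TimeSeries TimeField (g ^ 2) := by
  set x : TimeField := algebraMap TimeSeries TimeField f / algebraMap TimeSeries TimeField g
    with hx
  have hinj : Function.Injective (algebraMap TimeSeries TimeField) :=
    IsFractionRing.injective TimeSeries TimeField
  have hne : ∀ h : TimeSeries, h ≠ 0 → algebraMap TimeSeries TimeField h ≠ 0 := fun h hh h0 =>
    hh (hinj (by rw [h0, map_zero]))
  have hsec := IsLocalization.sec_spec (nonZeroDivisors TimeSeries) x
  unfold fracDeriv
  set f' : TimeSeries := (IsLocalization.sec (nonZeroDivisors TimeSeries) x).1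
  set g' : TimeSeries := ((IsLocalization.sec (nonZeroDivisors TimeSeries) x).2 : TimeSeries)
    with hg'
  have hg'0 : g' ≠ 0 :=
    nonZeroDivisors.ne_zero (IsLocalization.sec (nonZeroDivisors TimeSeries) x).2.2
  have key : f * g' = f' * g := by
    apply hinj
    rw [map_mul, map_mul, ← hsec, hx]
    field_simp [hne g hg]
  have dkey := congrArg (MvPowerSeries.pderiv ℂ s) key
  simp only [Derivation.leibniz, smul_eq_mul] at dkey
  dsimp only
  rw [div_eq_div_iff (hne _ (pow_ne_zero 2 hg'0)) (hne _ (pow_ne_zero 2 hg)), ← map_mul, ← map_mul]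
  congr 1
  linear_combination (-g * g') * dkey +
    (MvPowerSeries.pderiv ℂ s g' * g + MvPowerSeries.pderiv ℂ s g * g') * key

/-! ## Miwa shifts, Schur polynomials and the bilinear equation -/

/-- The series that replace the times in the Miwa shift `t ↦ t + ε [w]_a`, where
`[w] = (w, w ^ 2 / 2, w ^ 3 / 3, …)`. The times are embedded by `v` into the index type `ι`, and the
extra index `none` stands for the variable `w`. -/
def miwaArg {ι : Type} (v : Time → ι) (a : Fin 2) (ε : ℂ) (s : Time) :
    MvPowerSeries (Option ι) ℂ :=
  MvPowerSeries.X (some (v s)) +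
    if s.1 = a then
      MvPowerSeries.C (ε / ((s.2 : ℕ) : ℂ)) * MvPowerSeries.X none ^ (s.2 : ℕ)
    else 0

/-- The Miwa shift is a legitimate substitution. -/
theorem hasSubst_miwaArg {ι : Type} (v : Time → ι) (hv : Function.Injective v) (a : Fin 2) (ε : ℂ) :
    MvPowerSeries.HasSubst (miwaArg v a ε) where
  const_coeff s := by
    have h : MvPowerSeries.constantCoeff (miwaArg v a ε s) = 0 := by
      unfold miwaArg
      split_ifs <;> simp
    rw [h]
    exact IsNilpotent.zero
  coeff_zero d := by
    classical
    have h1 : {s : Time | (MvPowerSeries.coeff d)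
        (MvPowerSeries.X (some (v s)) : MvPowerSeries (Option ι) ℂ) ≠ 0}.Finite := by
      refine Set.Subsingleton.finite fun s hs s' hs' => ?_
      simp only [MvPowerSeries.coeff_X, ne_eq, ite_eq_right_iff, one_ne_zero, imp_false,
        not_not, Set.mem_ofPred_eq] at hs hs'
      have := Finsupp.single_left_injective (one_ne_zero : (1 : ℕ) ≠ 0) (hs.symm.trans hs')
      exact hv (Option.some_injective _ this)
    have h2 : {s : Time | s.2 = (d none).toPNat'}.Finite := by
      refine (Set.finite_univ.image fun b : Fin 2 => (b, (d none).toPNat')).subset ?_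
      rintro ⟨b, k⟩ hs
      exact ⟨b, trivial, by simpa using hs.symm⟩
    refine (h1.union h2).subset fun s hs => ?_
    by_contra hn
    simp only [Set.mem_union, Set.mem_ofPred_eq, not_or, not_not] at hn
    apply hs
    unfold miwaArg
    rw [map_add, hn.1, zero_add]
    split_ifs
    · rw [MvPowerSeries.coeff_C_mul, MvPowerSeries.coeff_X_pow, if_neg, mul_zero]
      intro hd
      apply hn.2
      rw [hd]
      simp
    · simp

/-- `f (t + ε [w]_a)` as a formal power series in the times and in `w`. -/
def miwaShift {ι : Type} (v : Time → ι) (a : Fin 2) (ε : ℂ) (f : TimeSeries) :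
    MvPowerSeries (Option ι) ℂ :=
  MvPowerSeries.subst (miwaArg v a ε) f

/-- The coefficient of `w ^ n`, for an integer `n` (zero if `n < 0`). -/
def wCoeff {ι : Type} (n : ℤ) (F : MvPowerSeries (Option ι) ℂ) : MvPowerSeries ι ℂ :=
  fun d => if 0 ≤ n then MvPowerSeries.coeff (d.optionElim n.toNat) F else 0

/-- The elementary Schur polynomial `p_n(x)`, that is, the coefficient of `z ^ n` in
`exp (∑_{k ≥ 1} x_k z ^ k)`: the sum over the partitions of `n` of the products of
`x_k ^ c / c !`, where `c` is the multiplicity of the part `k`. -/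
def schur {A : Type} [CommRing A] [Algebra ℂ A] (n : ℕ) (x : ℕ+ → A) : A :=
  ∑ p : n.Partition, ∏ k ∈ p.parts.toFinset,
    (((p.parts.count k).factorial : ℂ)⁻¹) • x k.toPNat' ^ p.parts.count k

/-- Formal power series in two independent sets of times `t` (left) and `t'` (right). -/
abbrev BiSeries : Type := MvPowerSeries (Time ⊕ Time) ℂ

/-- The coefficient of the `n`-th power in `exp (ξ (t^{(a)} - t'^{(a)}, ·))`. -/
def expCoeff (a : Fin 2) (n : ℕ) : BiSeries :=
  schur n fun k => MvPowerSeries.X (Sum.inl (a, k)) - MvPowerSeries.X (Sum.inr (a, k))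

/-- A monomial in `t, t'` occurs in only finitely many of the products of the coefficients of
the exponential with other series. -/
theorem expCoeff_mul_finite (a : Fin 2) (F : ℕ → BiSeries) (d : Time ⊕ Time →₀ ℕ) :
    {n : ℕ | MvPowerSeries.coeff d (expCoeff a n * F n) ≠ 0}.Finite := by
  classical
  let w : Time ⊕ Time → ℕ := Sum.elim (fun s => s.2) (fun s => s.2)
  have hX : ∀ s : Time ⊕ Time,
      (w s : ℕ∞) ≤ (MvPowerSeries.X s : BiSeries).weightedOrder w := by
    intro s
    refine MvPowerSeries.le_weightedOrder w fun d' hd' => ?_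
    rw [MvPowerSeries.coeff_X, if_neg]
    rintro rfl
    simp [Finsupp.weight_single] at hd'
  have hdiff : ∀ k : ℕ+, ((k : ℕ) : ℕ∞) ≤ (MvPowerSeries.X (Sum.inl (a, k)) -
      MvPowerSeries.X (Sum.inr (a, k)) : BiSeries).weightedOrder w := by
    intro k
    rw [sub_eq_add_neg]
    refine le_trans ?_ (MvPowerSeries.min_weightedOrder_le_add w)
    rw [MvPowerSeries.weightedOrder_neg]
    exact le_min (hX (Sum.inl (a, k))) (hX (Sum.inr (a, k)))
  have hn : ∀ n : ℕ, ∀ d' : Time ⊕ Time →₀ ℕ, Finsupp.weight w d' < n →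
      MvPowerSeries.coeff d' (expCoeff a n) = 0 := by
    intro n d' hd'
    unfold expCoeff schur
    rw [map_sum]
    refine Finset.sum_eq_zero fun p _ => ?_
    refine MvPowerSeries.coeff_eq_zero_of_lt_weightedOrder w (lt_of_lt_of_le
      (b := (n : ℕ∞)) (by exact_mod_cast hd') ?_)
    refine le_trans ?_ (MvPowerSeries.le_weightedOrder_prod w _ _)
    have hsum : (n : ℕ∞) = ∑ k ∈ p.parts.toFinset, ((p.parts.count k * k : ℕ) : ℕ∞) := by
      rw [← Nat.cast_sum]
      congr 1
      conv_lhs => rw [← p.parts_sum]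
      rw [Finset.sum_multiset_count]
      simp
    rw [hsum]
    refine Finset.sum_le_sum fun k hk => ?_
    have hk0 : 0 < k := p.parts_pos (by simpa using hk)
    refine le_trans ?_ (MvPowerSeries.le_weightedOrder_smul w)
    refine le_trans ?_ (MvPowerSeries.le_weightedOrder_pow w _)
    rw [nsmul_eq_mul, Nat.cast_mul]
    gcongr
    have := hdiff k.toPNat'
    rwa [Nat.toPNat'_coe, if_pos hk0] at this
  refine (Set.finite_Iic (Finsupp.weight w d)).subset fun n hne => ?_
  by_contra hlt
  apply hne
  rw [MvPowerSeries.coeff_mul]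
  refine Finset.sum_eq_zero fun x hx => ?_
  rw [hn n x.1, zero_mul]
  have hx' : x.1 + x.2 = d := by simpa using hx
  have := congrArg (Finsupp.weight w) hx'
  rw [map_add] at this
  simp only [Set.mem_Iic, not_le] at hlt
  omega

/-- The residue `Res_z z ^ p exp (ξ (t^{(1)} - t'^{(1)}, z)) f (t - [z⁻¹]_1) g (t' + [z⁻¹]_1)`, that
is, the contour integral over a large circle: the coefficient of `z ^ (-1)`, where
`z ^ p · z ^ n · z ^ (-j)` contributes for `j = n + p + 1`. For each monomial in `t, t'` only
finitely many `n` contribute, by `expCoeff_mul_finite`. -/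
def resInfinity (p : ℤ) (f g : TimeSeries) : BiSeries := fun d =>
  ∑ᶠ n : ℕ, MvPowerSeries.coeff d (expCoeff 0 n *
    wCoeff (n + p + 1) (miwaShift Sum.inl 0 (-1) f * miwaShift Sum.inr 0 1 g))

/-- The residue `Res_z z ^ p exp (ξ (t^{(2)} - t'^{(2)}, z⁻¹)) f (t - [z]_2) g (t' + [z]_2)`, that is,
the contour integral over a small circle: the coefficient of `z ^ (-1)`, where
`z ^ p · z ^ (-n) · z ^ j` contributes for `j = n - p - 1`. For each monomial in `t, t'` only
finitely many `n` contribute, by `expCoeff_mul_finite`. -/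
def resZero (p : ℤ) (f g : TimeSeries) : BiSeries := fun d =>
  ∑ᶠ n : ℕ, MvPowerSeries.coeff d (expCoeff 1 n *
    wCoeff (n - p - 1) (miwaShift Sum.inl 1 (-1) f * miwaShift Sum.inr 1 1 g))

def e₁ : ℤ × ℤ := (1, 0)
def e₂ : ℤ × ℤ := (0, 1)
def e : ℤ × ℤ := (1, 1)

/-- The bilinear equation of the two-component discrete KP hierarchy. -/
def IsTau (τ : ℤ × ℤ → TimeSeries) : Prop :=
  ∀ m m' : ℤ × ℤ, m'.1 - m'.2 ≤ m.1 - m.2 →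
    resInfinity (m.1 - m'.1) (τ m) (τ m') = resZero (m.2 - m'.2) (τ (m + e)) (τ (m' - e))

/-! ## Formal operators in the two shifts -/

/-- Formal operators `∑ A_{j₁ j₂}(m) Λ₁ ^ j₁ Λ₂ ^ j₂`, with arbitrary coefficients:
`A (j₁, j₂) m` is the coefficient at `Λ₁ ^ j₁ Λ₂ ^ j₂`, a function of the lattice point `m` and
of the times. -/
def Op : Type := ℤ × ℤ → ℤ × ℤ → TimeField

namespace Op

instance : AddCommGroup Op := inferInstanceAs (AddCommGroup (ℤ × ℤ → ℤ × ℤ → TimeField))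

/-- `Λ ^ i · f(m) = f(m + i) Λ ^ i`. The sum is finite for two operators of `E 0`, and for two
operators of `E 1` (see `mul_finite`). -/
instance : Mul Op :=
  ⟨fun A B => fun k m => ∑ᶠ i : ℤ × ℤ, A i m * B (k - i) (m + i)⟩

/-- `Λ₁ ^ v₁ Λ₂ ^ v₂`. -/
def lam (v : ℤ × ℤ) : Op := fun k _ => if k = v then 1 else 0

instance : One Op := ⟨lam 0⟩

/-- Multiplication by a function. -/
def fn (f : ℤ × ℤ → TimeField) : Op := fun k m => if k = 0 then f m else 0

/-- Left multiplication of the coefficients by a function. -/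
def smulFn (f : ℤ × ℤ → TimeField) (A : Op) : Op := fun k m => f m * A k m

def npow (A : Op) : ℕ → Op
  | 0 => 1
  | n + 1 => npow A n * A

/-- `A(m) ↦ A(m + v)`, the shift of the coefficients. -/
def shift (v : ℤ × ℤ) (A : Op) : Op := fun k m => A k (m + v)

/-- The derivative of the coefficients with respect to a time. -/
def deriv (s : Time) (A : Op) : Op := fun k m => fracDeriv s (A k m)

def comm (A B : Op) : Op := A * B - B * A

/-- `E 0` consists of the Laurent series in `Λ₁⁻¹` whose coefficients are Laurent polynomials
in `Λ₂`; `E 1` consists of the Laurent series in `Λ₂` whose coefficients are Laurent polynomials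
in `Λ₁`. -/
def E (a : Fin 2) : Set Op :=
  if a = 0 then
    {A | (∃ M : ℤ, ∀ k : ℤ × ℤ, M < k.1 → A k = 0) ∧ ∀ i : ℤ, {j : ℤ | A (i, j) ≠ 0}.Finite}
  else
    {A | (∃ M : ℤ, ∀ k : ℤ × ℤ, k.2 < M → A k = 0) ∧ ∀ j : ℤ, {i : ℤ | A (i, j) ≠ 0}.Finite}

theorem mul_apply (A B : Op) (k m : ℤ × ℤ) :
    (A * B) k m = ∑ᶠ i : ℤ × ℤ, A i m * B (k - i) (m + i) := rfl

/-- The sums in the product of two operators of `E a` are finite. -/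
theorem mul_finite (a : Fin 2) {A B : Op} (hA : A ∈ E a) (hB : B ∈ E a) (k m : ℤ × ℤ) :
    {i : ℤ × ℤ | A i m * B (k - i) (m + i) ≠ 0}.Finite := by
  unfold E at hA hB
  split_ifs at hA hB
  · obtain ⟨⟨M, hM⟩, hf⟩ := hA
    obtain ⟨⟨N, hN⟩, -⟩ := hB
    refine ((Set.finite_Icc (k.1 - N) M).biUnion
      fun i _ => (hf i).image fun j => (i, j)).subset fun i hi => ?_
    have h1 : A i ≠ 0 := fun h => hi (by rw [h]; exact zero_mul _)
    have h2 : B (k - i) ≠ 0 := fun h => hi (by rw [h]; exact mul_zero _)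
    have h3 : i.1 ≤ M := not_lt.1 fun h => h1 (hM i h)
    have h4 : k.1 - i.1 ≤ N := not_lt.1 fun h => h2 (hN (k - i) h)
    exact Set.mem_biUnion (x := i.1) ⟨by linarith, h3⟩ ⟨i.2, h1, rfl⟩
  · obtain ⟨⟨M, hM⟩, hf⟩ := hA
    obtain ⟨⟨N, hN⟩, -⟩ := hB
    refine ((Set.finite_Icc M (k.2 - N)).biUnion
      fun j _ => (hf j).image fun i => (i, j)).subset fun i hi => ?_
    have h1 : A i ≠ 0 := fun h => hi (by rw [h]; exact zero_mul _)
    have h2 : B (k - i) ≠ 0 := fun h => hi (by rw [h]; exact mul_zero _)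
    have h3 : M ≤ i.2 := not_lt.1 fun h => h1 (hM i h)
    have h4 : N ≤ k.2 - i.2 := not_lt.1 fun h => h2 (hN (k - i) h)
    exact Set.mem_biUnion (x := i.2) ⟨h3, by linarith⟩ ⟨i.1, h1, rfl⟩

/-- The Laurent series in `Λ₁⁻¹` alone (`a = 0`), in `Λ₂` alone (`a = 1`). -/
def E₀ (a : Fin 2) : Set Op :=
  if a = 0 then {A | A ∈ E 0 ∧ ∀ k : ℤ × ℤ, k.2 ≠ 0 → A k = 0}
  else {A | A ∈ E 1 ∧ ∀ k : ℤ × ℤ, k.1 ≠ 0 → A k = 0}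

open Classical in
/-- The two-sided inverse within `E₀ a`, where there is one. -/
def inv (a : Fin 2) (A : Op) : Op :=
  if h : ∃ B ∈ E₀ a, A * B = 1 ∧ B * A = 1 then h.choose else 0

/-- `P` is the component of `A` in `E₀ a` along a decomposition `A = P + Q H` with `Q` in `E a`. -/
def IsProj (a : Fin 2) (H A P : Op) : Prop := P ∈ E₀ a ∧ ∃ Q ∈ E a, A = P + Q * H

open Classical in
/-- The projection of `E a = E₀ a ⊕ (E a) H` to `E₀ a`. -/
def proj (a : Fin 2) (H A : Op) : Op := if h : ∃ P, IsProj a H A P then h.choose else 0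

/-- `A_{1, ≥ 0}`. -/
def nonneg₁ (A : Op) : Op := fun k m => if 0 ≤ k.1 then A k m else 0

/-- `Δ₂ = Λ₂ - 1`. -/
def Δ₂ : Op := lam e₂ - 1

/-- `Δ₂^* = Λ₂⁻¹ - 1`. -/
def Δ₂star : Op := lam (-e₂) - 1

/-- `Δ₂^{*-1} = ∑_{j ≥ 1} Λ₂ ^ j`. -/
def Δ₂starInv : Op := fun k _ => if k.1 = 0 ∧ 1 ≤ k.2 then 1 else 0

/-- The coefficient `b_j` in `A = ∑_j b_j Δ₂^{* j}`, for `A = ∑_i a_i Λ₂ ^ i` in `E₀ 1`: it is found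
by inserting `Λ₂ ^ i = (Δ₂^* + 1) ^ (-i) = ∑_{l ≥ 0} (-i choose l) Δ₂^{* (-i - l)}`, so that
`i = -(j + l)`. -/
def starCoeff (A : Op) (j : ℤ) : ℤ × ℤ → TimeField := fun m =>
  ∑ᶠ l : ℕ, ((Ring.choose (j + l) l : ℤ) : TimeField) * A (0, -(j + l)) m

/-- `A_{Δ₂^*, ≥ 1} = ∑_{j ≥ 1} b_j Δ₂^{* j}`, a finite sum for `A` in `E₀ 1`. -/
def starPos (A : Op) : Op :=
  ∑ᶠ j : ℕ, smulFn (starCoeff A (j + 1)) (npow Δ₂star (j + 1))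

end Op

/-! ## Wave operators and Lax operators of a tau function -/

open Op

/-- The wave operators. The coefficient of `Λ₁ ^ (-n)` in `S₁` is that of `z ^ (-n)` in
`τ_m(t - [z⁻¹]_1) / τ_m(t)`; the coefficient of `Λ₂ ^ n` in `S₂` is that of `z ^ n` in
`τ_{m+e}(t - [z]_2) / τ_m(t)`. In other words, the wave functions are
`Ψ₁ = z ^ m₁ exp (ξ (t^{(1)}, z)) τ_m(t - [z⁻¹]_1) / τ_m(t) = S₁ (z ^ m₁) exp (ξ (t^{(1)}, z))` and
`Ψ₂ = z ^ m₂ exp (ξ (t^{(2)}, z⁻¹)) τ_{m+e}(t - [z]_2) / τ_m(t) = S₂ (z ^ m₂) exp (ξ (t^{(2)}, z⁻¹))`. -/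
def S (τ : ℤ × ℤ → TimeSeries) (a : Fin 2) : Op :=
  if a = 0 then fun k m =>
    if k.2 = 0 then
      algebraMap TimeSeries TimeField (wCoeff (-k.1) (miwaShift id 0 (-1) (τ m))) /
        algebraMap TimeSeries TimeField (τ m)
    else 0
  else fun k m =>
    if k.1 = 0 then
      algebraMap TimeSeries TimeField (wCoeff k.2 (miwaShift id 1 (-1) (τ (m + e)))) /
        algebraMap TimeSeries TimeField (τ m)
    else 0

/-- `S_a⁻¹`. -/
def Sinv (τ : ℤ × ℤ → TimeSeries) (a : Fin 2) : Op := inv a (S τ a)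

/-- `L₁ = S₁ Λ₁ S₁⁻¹` and `L₂ = S₂ Λ₂⁻¹ S₂⁻¹`. -/
def L (τ : ℤ × ℤ → TimeSeries) (a : Fin 2) : Op :=
  S τ a * (if a = 0 then lam e₁ else lam (-e₂)) * Sinv τ a

def ρ (τ : ℤ × ℤ → TimeSeries) : ℤ × ℤ → TimeField := fun m =>
  algebraMap TimeSeries TimeField (τ m) / algebraMap TimeSeries TimeField (τ (m + e₁)) *
    (algebraMap TimeSeries TimeField (τ (m + e + e₁)) /
      algebraMap TimeSeries TimeField (τ (m + e)))

/-- `H = Λ₁ Δ₂ + ρ`. -/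
def H (τ : ℤ × ℤ → TimeSeries) : Op := lam e₁ * Δ₂ + fn (ρ τ)

/-- `B_k^{(1)} = (L₁ ^ k)_{1, ≥ 0}` and `B_k^{(2)} = (L₂ ^ k)_{Δ₂^*, ≥ 1}`. -/
def B (τ : ℤ × ℤ → TimeSeries) (a : Fin 2) (k : ℕ+) : Op :=
  if a = 0 then nonneg₁ (npow (L τ 0) k) else starPos (npow (L τ 1) k)

/-- `C_k^{(1)}(m) = B_k^{(1)}(m + e)` and `C_k^{(2)}(m) = Δ₂^* B_k^{(2)}(m + e) Δ₂^{*-1}`. -/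
def C (τ : ℤ × ℤ → TimeSeries) (a : Fin 2) (k : ℕ+) : Op :=
  if a = 0 then shift e (B τ 0 k) else Δ₂star * shift e (B τ 1 k) * Δ₂starInv

/-- The projection `π_b` on `E b`, for the operator `H` of the tau function. -/
def π (τ : ℤ × ℤ → TimeSeries) (b : Fin 2) (A : Op) : Op := proj b (H τ) A

end TwoDKP

end

noncomputable section

namespace TwoDKP

/-! ## Formal power series: density, chain rule, extraction of coefficients -/

section PowerSeriesTools

open MvPowerSeries

/-! The bilinear equation is needed only to first order at `t' = t`. Let `w = z⁻¹` for the first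
component and `w = z` for the second, and strip the wave functions of their exponentials and of `z ^
m_b`. At equal times the exponentials become `1`, and the derivative in `t_k^{(b)}` adds a term with
the factor `w ^ (-k)` on the side of component `b`. So the residue pairings of the wave functions,
and of their corrected derivatives, with all dual wave functions agree for the two components
(`IsTau.coeff_wave_mul`, `IsTau.coeff_laurentDeriv_wave_mul`).

This pairing is nondegenerate (`eq_zero_of_pairing`): if `X` has order at least `1 - c`, `Y` has
order at least `c`, and their pairings agree, then `X = Y = 0`, because `m'` can be chosen so that
one side is a nonzero leading coefficient and the other is zero. Hence a linear equation for both
wave functions holds as soon as its lowest coefficients match. For `H` (with `c = 1`) the matching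
is the cancellation `1 - 1` in the first component and the definition of `ρ` in the second. For the
time evolution (with `c = 0`) the truncations that define `B` provide it: the remainder of `L ^ k`
starts in the right degree on the wave function of the same component, and on the other component
`Λ₁` preserves the order while a right factor `Δ₂^*` removes the constant leading coefficient `1`.

The rest is algebra. On the vacuum `z ^ m_b` the other shift acts as `1`, so an equation for the
wave function is a congruence for operators times `S_b` modulo the left ideal generated by that
shift minus `1` (`vacuumIdeal`). The ring `E b` is the direct sum of `E₀ b` and this ideal. Since `H
S_b` is a unit times the shift minus `1` (`HE_mul_SE_mem`, `exists_left_inv_mul`), the left ideal of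
`H` is the annihilator of the wave function, and the decomposition follows by conjugation with
`S_b`. Each remaining identity states that some element of `E₀ b` vanishes, and it does so because
this element annihilates the wave function (`eq_zero_of_mul_SE_mem`). -/

open scoped MvPowerSeries.WithPiTopology in
/-- Two continuous maps of power series that agree on polynomials are equal. -/
theorem eq_of_eqOn_polynomials {σ τ R : Type} [CommRing R] [TopologicalSpace R]
    [DiscreteTopology R]
    {F G : MvPowerSeries σ R → MvPowerSeries τ R} (hF : Continuous F) (hG : Continuous G)
    (h : ∀ p : MvPolynomial σ R, F p = G p) : F = G :=
  WithPiTopology.denseRange_toMvPowerSeries.equalizer hF hG (funext h)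

open scoped MvPowerSeries.WithPiTopology in
theorem continuous_pderiv {σ R : Type} [CommRing R] [TopologicalSpace R]
    [DiscreteTopology R] (i : σ) :
    Continuous (pderiv R i : MvPowerSeries σ R → MvPowerSeries σ R) := by
  refine continuous_pi fun d => ?_
  have h : (fun f : MvPowerSeries σ R => (pderiv R i f) d) =
      fun f => coeff (d + Finsupp.single i 1) f * ((d i : R) + 1) := by
    funext f
    exact coeff_pderiv f d
  rw [h]
  exact (continuous_of_discreteTopology (f := fun x : R => x * ((d i : R) + 1))).comp
    (WithPiTopology.continuous_coeff R _)

open scoped MvPowerSeries.WithPiTopology in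
/-- The chain rule for substitutions by series whose derivatives are constants. -/
theorem pderiv_subst {σ τ R : Type} [CommRing R] {a : σ → MvPowerSeries τ R}
    (ha : HasSubst a) (i : τ) (D : Derivation R (MvPolynomial σ R) (MvPolynomial σ R))
    (D' : MvPowerSeries σ R → MvPowerSeries σ R)
    (hD' : ∀ [TopologicalSpace R] [DiscreteTopology R], Continuous D')
    (hDD' : ∀ p : MvPolynomial σ R, D' p = D p)
    (h : ∀ s, pderiv R i (a s) = subst a (D (MvPolynomial.X s) : MvPowerSeries σ R))
    (f : MvPowerSeries σ R) :
    pderiv R i (subst a f) = subst a (D' f) := by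
  -- For discrete coefficients substitution is continuous and polynomials are dense, so an induction
  -- on polynomials suffices.
  let _ : UniformSpace R := ⊥
  have _ : DiscreteUniformity R := ⟨rfl⟩
  have hs : Continuous (subst a : MvPowerSeries σ R → MvPowerSeries τ R) := continuous_subst ha
  refine congrFun (eq_of_eqOn_polynomials (F := fun f => pderiv R i (subst a f))
    (G := fun f => subst a (D' f)) ((continuous_pderiv i).comp hs) (hs.comp hD') fun p => ?_) f
  simp only [hDD']
  induction p using MvPolynomial.induction_on with
  | C r => 
    rw [MvPolynomial.coe_C, subst_C, pderiv_C, ← MvPolynomial.algebraMap_eq, D.map_algebraMap,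
      MvPolynomial.coe_zero, ← coe_substAlgHom ha, map_zero]
  | add p q hp hq =>
    rw [map_add, MvPolynomial.coe_add, MvPolynomial.coe_add, subst_add ha, subst_add ha, map_add,
      hp, hq]
  | mul_X p s hp =>
    rw [MvPolynomial.coe_mul, subst_mul ha, Derivation.leibniz, Derivation.leibniz, hp,
      MvPolynomial.coe_X, subst_X ha, h s, MvPolynomial.coe_add, smul_eq_mul, smul_eq_mul,
      smul_eq_mul, smul_eq_mul, MvPolynomial.coe_mul, MvPolynomial.coe_mul, subst_add ha,
      subst_mul ha, subst_mul ha, MvPolynomial.coe_X, subst_X ha]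

end PowerSeriesTools

/-! ### Miwa shifts and the expansion in the extra variable -/

section Miwa

open MvPowerSeries

variable {ι κ : Type}

theorem coeff_wCoeff_natCast (n : ℕ) (F : MvPowerSeries (Option ι) ℂ) (d : ι →₀ ℕ) :
    coeff d (wCoeff n F) = coeff (d.optionElim n) F := by
  change (if (0 : ℤ) ≤ n then coeff (d.optionElim (n : ℤ).toNat) F else 0) = _
  simp

theorem wCoeff_of_neg {n : ℤ} (hn : n < 0) (F : MvPowerSeries (Option ι) ℂ) :
    wCoeff n F = 0 := by
  funext d
  exact if_neg (not_le.2 hn)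

/-- The expansion in powers of the extra variable. -/
def wSeries (F : MvPowerSeries (Option ι) ℂ) : LaurentSeries (MvPowerSeries ι ℂ) :=
  HahnSeries.ofPowerSeries ℤ _ (optionEquivLeft ι ℂ F)

theorem coeff_wSeries (n : ℤ) (F : MvPowerSeries (Option ι) ℂ) :
    (wSeries F).coeff n = wCoeff n F := by
  unfold wSeries
  rw [PowerSeries.coeff_coe]
  split_ifs with h
  · exact (wCoeff_of_neg h F).symm
  · lift n to ℕ using not_lt.1 h
    ext d
    rw [Int.natAbs_natCast, coeff_coeff_optionEquivLeft, coeff_wCoeff_natCast]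

theorem wSeries_mul (F G : MvPowerSeries (Option ι) ℂ) :
    wSeries (F * G) = wSeries F * wSeries G := by
  simp [wSeries]

theorem wCoeff_pderiv (n : ℤ) (x : ι) (F : MvPowerSeries (Option ι) ℂ) :
    wCoeff n (pderiv ℂ (some x) F) = pderiv ℂ x (wCoeff n F) := by
  rcases lt_or_ge n 0 with h | h
  · rw [wCoeff_of_neg h, wCoeff_of_neg h, map_zero]
  · lift n to ℕ using h
    ext d
    rw [coeff_wCoeff_natCast, coeff_pderiv, coeff_pderiv, coeff_wCoeff_natCast,
      Finsupp.optionElim_apply_some]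
    congr 2
    congr 1
    ext y
    cases y <;> simp [Finsupp.optionElim_apply_eq_elim, Finsupp.single_apply_left,
      Option.some_injective]

theorem pderiv_miwaArg (v : Time → ι) (a : Fin 2) (ε : ℂ) (x : ι) (s : Time) :
    pderiv ℂ (some x) (miwaArg v a ε s) =
      pderiv ℂ (some x) (X (some (v s)) : MvPowerSeries (Option ι) ℂ) := by
  unfold miwaArg
  rw [map_add, add_eq_left]
  split_ifs
  · rw [Derivation.leibniz, pderiv_C, pderiv_pow, pderiv_X_of_ne (by simp)]
    simp
  · simp

-- The increment of the times in a Miwa shift depends on `w` alone, so differentiation in the times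
-- commutes with the shift.
open scoped MvPowerSeries.WithPiTopology in
theorem pderiv_miwaShift {v : Time → ι} (hv : Function.Injective v) (a : Fin 2) (ε : ℂ) (s : Time)
    (f : TimeSeries) :
    pderiv ℂ (some (v s)) (miwaShift v a ε f) = miwaShift v a ε (pderiv ℂ s f) := by
  have ha := hasSubst_miwaArg v hv a ε
  refine pderiv_subst ha _ (MvPolynomial.pderiv s) _
    (fun [_] [_] => continuous_pderiv s) (pderiv_coe ·) (fun s' => ?_) f
  rw [pderiv_miwaArg, ← pderiv_coe, MvPolynomial.coe_X, ← coe_substAlgHom ha]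
  rcases eq_or_ne s s' with rfl | h
  · rw [pderiv_X_self, pderiv_X_self, map_one]
  · rw [pderiv_X_of_ne fun h' => h (hv (Option.some_injective _ h')).symm, pderiv_X_of_ne h.symm,
      map_zero]

open scoped MvPowerSeries.WithPiTopology in
theorem pderiv_miwaShift_of_notMem {v : Time → ι} (hv : Function.Injective v) (a : Fin 2) (ε : ℂ)
    {x : ι} (hx : x ∉ Set.range v) (f : TimeSeries) :
    pderiv ℂ (some x) (miwaShift v a ε f) = 0 := by
  have ha := hasSubst_miwaArg v hv a ε
  have h0 : subst (miwaArg v a ε) (0 : TimeSeries) = 0 := by rw [← coe_substAlgHom ha, map_zero]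
  rw [← h0]
  refine pderiv_subst ha _ 0 (fun _ => 0) continuous_const (fun p => by simp) (fun s' => ?_) f
  rw [pderiv_miwaArg, pderiv_X_of_ne fun h' => hx ⟨s', Option.some_injective _ h'⟩,
    Derivation.zero_apply, MvPolynomial.coe_zero, h0]

-- At `w = 0` the Miwa shift is the identity. Taking the constant term in `w` is a ring
-- homomorphism, so the check reduces to generators and extends by density.
open scoped MvPowerSeries.WithPiTopology in
theorem wCoeff_zero_miwaShift (a : Fin 2) (ε : ℂ) (f : TimeSeries) :
    wCoeff 0 (miwaShift id a ε f) = f := by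
  let _ : UniformSpace ℂ := ⊥
  have _ : DiscreteUniformity ℂ := ⟨rfl⟩
  have ha := hasSubst_miwaArg id Function.injective_id a ε
  let φ : MvPowerSeries (Option Time) ℂ →+* TimeSeries :=
    PowerSeries.constantCoeff.comp (optionEquivLeft Time ℂ : _ →+* _)
  have hφ : ∀ F, wCoeff 0 F = φ F := by
    intro F
    rw [← coeff_wSeries]
    exact (HahnSeries.ofPowerSeries_apply_coeff _ 0).trans
      (PowerSeries.coeff_zero_eq_constantCoeff_apply _)
  refine congrFun (eq_of_eqOn_polynomials (F := fun f => wCoeff 0 (miwaShift id a ε f))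
    (G := id) (continuous_pi fun d => ?_) continuous_id fun p => ?_) f
  · exact (WithPiTopology.continuous_coeff ℂ (d.optionElim 0)).comp (continuous_subst ha)
  · simp only [hφ, id]
    unfold miwaShift
    induction p using MvPolynomial.induction_on with
    | C r => simp [φ]
    | add p q hp hq => rw [MvPolynomial.coe_add, subst_add ha, map_add, hp, hq]
    | mul_X p s hp =>
      rw [MvPolynomial.coe_mul, subst_mul ha, map_mul, hp, MvPolynomial.coe_X, subst_X ha]
      congr 1
      unfold miwaArg
      split_ifs <;> simp [φ]

/-- With `g` the map that identifies `t'` with `t`, this turns the shifts of both sets of times into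
shifts of a single set. -/
theorem rename_miwaShift (v : Time → ι) (hv : Function.Injective v) (a : Fin 2) (ε : ℂ)
    (g : ι → Time) [Filter.TendstoCofinite g] [Filter.TendstoCofinite (Option.map g)]
    (hg : ∀ s, g (v s) = s) (f : TimeSeries) :
    rename (Option.map g) (miwaShift v a ε f) = miwaShift id a ε f := by
  unfold miwaShift
  rw [rename_eq_subst, subst_comp_subst_apply (hasSubst_miwaArg v hv a ε) (HasSubst.X_comp _)]
  congr 1
  funext s
  rw [← rename_eq_subst]
  unfold miwaArg
  split_ifs <;> simp [hg]

theorem mapDomain_optionElim (g : ι → κ) (n : ℕ) (c : ι →₀ ℕ) :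
    Finsupp.mapDomain (Option.map g) (c.optionElim n) = (Finsupp.mapDomain g c).optionElim n := by
  classical
  have h : ∀ {ν : Type} (c : ν →₀ ℕ), c.optionElim n = Finsupp.single none n +
      Finsupp.mapDomain some c := by
    intro ν c
    ext y
    cases y with
    | none => simp [Finsupp.mapDomain_of_notMem_range]
    | some y =>
      simp [Finsupp.mapDomain_apply (Option.some_injective ν)]
  rw [h, h, Finsupp.mapDomain_add, Finsupp.mapDomain_single, ← Finsupp.mapDomain_comp,
    ← Finsupp.mapDomain_comp]
  rfl

theorem wCoeff_rename (n : ℤ) (g : ι → κ) [Filter.TendstoCofinite g]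
    [Filter.TendstoCofinite (Option.map g)] (F : MvPowerSeries (Option ι) ℂ) :
    wCoeff n (rename (Option.map g) F) = rename g (wCoeff n F) := by
  rcases lt_or_ge n 0 with h | h
  · rw [wCoeff_of_neg h, wCoeff_of_neg h, map_zero]
  · lift n to ℕ using h
    ext d
    rw [coeff_wCoeff_natCast, coeff_rename, coeff_rename]
    symm
    -- Renaming leaves the exponent of `none` unchanged, so the fibre over `d.optionElim n` is the
    -- fibre over `d` with `n` attached.
    refine Finset.sum_nbij' (fun c => c.optionElim n) (fun c => c.some) ?_ ?_ ?_ ?_ ?_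
    · intro c hc
      simp only [Set.Finite.mem_toFinset, Set.mem_preimage, Set.mem_singleton_iff] at hc ⊢
      rw [mapDomain_optionElim, hc]
    · intro c hc
      simp only [Set.Finite.mem_toFinset, Set.mem_preimage, Set.mem_singleton_iff] at hc ⊢
      rw [← Finsupp.optionElim_some c, mapDomain_optionElim] at hc
      simpa using congrArg Finsupp.some hc
    · intro c _
      simp
    · intro c hc
      simp only [Set.Finite.mem_toFinset, Set.mem_preimage, Set.mem_singleton_iff] at hc
      rw [← Finsupp.optionElim_some c, mapDomain_optionElim] at hc
      have hn := DFunLike.congr_fun hc none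
      rw [Finsupp.optionElim_apply_none, Finsupp.optionElim_apply_none] at hn
      rw [← hn, Finsupp.optionElim_some]
    · intro c _
      rw [coeff_wCoeff_natCast]

end Miwa

/-! ## The bilinear equation on the diagonal -/

section Diagonal

open MvPowerSeries

/-- The identification of the two sets of times. -/
def mergeTimes : Time ⊕ Time → Time := Sum.elim id id

instance tendstoCofinite_mergeTimes : Filter.TendstoCofinite mergeTimes := by
  rw [Filter.tendstoCofinite_iff_finite_preimage_singleton]
  intro b
  refine (Set.toFinite {Sum.inl b, Sum.inr b}).subset ?_
  rintro (s | s) hs <;> simpa [mergeTimes] using hs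

instance tendstoCofinite_option_mergeTimes : Filter.TendstoCofinite (Option.map mergeTimes) := by
  rw [Filter.tendstoCofinite_iff_finite_preimage_singleton]
  intro b
  cases b with
  | none => exact (Set.toFinite {none}).subset fun y hy => by simpa using hy
  | some b =>
    refine (Set.toFinite {some (Sum.inl b), some (Sum.inr b)}).subset ?_
    rintro (_ | s | s) hs
    · simp at hs
    · simpa [mergeTimes] using hs
    · simpa [mergeTimes] using hs

/-- `G` is the sum of the locally finite family `F`. -/
def IsSumOf {ι : Type} (G : MvPowerSeries ι ℂ) (F : ℕ → MvPowerSeries ι ℂ) : Prop :=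
  ∀ d, (fun n => coeff d (F n)).HasFiniteSupport ∧ coeff d G = ∑ᶠ n, coeff d (F n)

theorem IsSumOf.pderiv {ι : Type} {G : MvPowerSeries ι ℂ} {F : ℕ → MvPowerSeries ι ℂ}
    (h : IsSumOf G F) (i : ι) :
    IsSumOf (MvPowerSeries.pderiv ℂ i G) fun n => MvPowerSeries.pderiv ℂ i (F n) := by
  intro d
  simp only [coeff_pderiv]
  refine ⟨(h (d + Finsupp.single i 1)).1.subset fun n hn => left_ne_zero_of_mul hn, ?_⟩
  rw [(h _).2, finsum_mul]

/-- Only finitely many monomials are renamed to a given one, so the relevant indices form a finite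
union of finite sets. -/
theorem IsSumOf.rename {ι κ : Type} {G : MvPowerSeries ι ℂ} {F : ℕ → MvPowerSeries ι ℂ}
    (h : IsSumOf G F) (g : ι → κ) [Filter.TendstoCofinite g] :
    IsSumOf (MvPowerSeries.rename g G) fun n => MvPowerSeries.rename g (F n) := by
  intro d
  simp only [coeff_rename]
  refine ⟨?_, ?_⟩
  · refine (Set.Finite.biUnion (Finset.finite_toSet
      (Filter.TendstoCofinite.finite_preimage_singleton (Finsupp.mapDomain g) d).toFinset)
      fun c _ => (h c).1).subset fun n hn => ?_
    obtain ⟨c, hc, hne⟩ := Finset.exists_ne_zero_of_sum_ne_zero hn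
    exact Set.mem_biUnion hc hne
  · rw [finsum_sum_comm _ _ fun c _ => (h c).1]
    exact Finset.sum_congr rfl fun c _ => (h c).2

theorem IsSumOf.eq_of_single {ι : Type} {G : MvPowerSeries ι ℂ} {F : ℕ → MvPowerSeries ι ℂ}
    (h : IsSumOf G F) (k : ℕ) (hF : ∀ n, n ≠ k → F n = 0) : G = F k := by
  ext d
  rw [(h d).2, finsum_eq_single _ k fun n hn => by rw [hF n hn, map_zero]]

/-! ### Schur polynomials to first order -/

section Schur

variable {A B : Type} [CommRing A] [Algebra ℂ A] [CommRing B] [Algebra ℂ B]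

/-- Modulo the square of an ideal that contains the arguments, only the linear term of a Schur
polynomial survives. -/
theorem schur_sub_mem (J : Ideal A) (x : ℕ+ → A) (hx : ∀ k, x k ∈ J) (n : ℕ+) :
    schur n x - x n ∈ J ^ 2 := by
  classical
  unfold schur
  have hn : (n : ℕ) ≠ 0 := n.ne_zero
  have hterm : ∏ k ∈ (Nat.Partition.indiscrete (n : ℕ)).parts.toFinset,
      (((((Nat.Partition.indiscrete (n : ℕ)).parts.count k).factorial : ℂ)⁻¹) •
        x k.toPNat' ^ (Nat.Partition.indiscrete (n : ℕ)).parts.count k) = x n := by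
    simp
  rw [← Finset.add_sum_erase _ _ (Finset.mem_univ (Nat.Partition.indiscrete (n : ℕ))), hterm,
    add_sub_cancel_left]
  refine Ideal.sum_mem _ fun p hp => ?_
  -- A partition of `n` other than `n` itself has at least two parts, so its product has at least
  -- two factors in `J`.
  have hcard : 2 ≤ p.parts.card := by
    by_contra! hlt
    interval_cases hc : p.parts.card
    · have := p.parts_sum
      rw [Multiset.card_eq_zero.1 hc, Multiset.sum_zero] at this
      exact hn this.symm
    · obtain ⟨a, ha⟩ := Multiset.card_eq_one.1 hc
      have := p.parts_sum
      rw [ha, Multiset.sum_singleton] at this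
      refine Finset.ne_of_mem_erase hp (Nat.Partition.ext ?_)
      rw [ha, Nat.Partition.indiscrete_parts hn, this]
  refine Ideal.pow_le_pow_right hcard ?_
  rw [← Multiset.toFinset_sum_count_eq, ← Finset.prod_pow_eq_pow_sum]
  refine Ideal.prod_mem_prod fun k _ => ?_
  rw [Algebra.smul_def]
  exact Ideal.mul_mem_left _ _ (Ideal.pow_mem_pow (hx _) _)

theorem schur_mem (J : Ideal A) (x : ℕ+ → A) (hx : ∀ k, x k ∈ J) (n : ℕ+) :
    schur n x ∈ J := by
  have h := J.add_mem (Ideal.pow_le_self two_ne_zero (schur_sub_mem J x hx n)) (hx n)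
  rwa [sub_add_cancel] at h

theorem schur_zero (x : ℕ+ → A) : schur 0 x = 1 := by
  unfold schur
  rw [Fintype.sum_unique]
  simp

end Schur

theorem expCoeff_zero (a : Fin 2) : expCoeff a 0 = 1 := schur_zero _

theorem rename_timeDiff (a : Fin 2) (k : ℕ+) :
    rename mergeTimes (X (Sum.inl (a, k)) - X (Sum.inr (a, k)) : BiSeries) = 0 := by
  rw [map_sub, rename_X, rename_X]
  exact sub_self _

theorem rename_expCoeff (a : Fin 2) (n : ℕ) (hn : n ≠ 0) :
    rename mergeTimes (expCoeff a n) = 0 := by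
  lift n to ℕ+ using Nat.pos_of_ne_zero hn
  exact schur_mem (RingHom.ker (rename mergeTimes : BiSeries →ₐ[ℂ] TimeSeries)) _
    (rename_timeDiff a) n

/-- Let `J` be the kernel of setting `t' = t`. A derivation maps `J ^ 2` into `J`, and modulo `J ^
2` the exponential coefficient is its linear term, so only the derivative of that term survives. -/
theorem rename_pderiv_expCoeff (a b : Fin 2) (k : ℕ+) (n : ℕ) :
    rename mergeTimes (MvPowerSeries.pderiv ℂ (Sum.inl (b, k)) (expCoeff a n)) =
      if a = b ∧ n = k then 1 else 0 := by
  classical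
  rcases eq_or_ne n 0 with rfl | hn
  · rw [expCoeff_zero, pderiv_one, map_zero, if_neg fun h => k.ne_zero h.2.symm]
  lift n to ℕ+ using Nat.pos_of_ne_zero hn
  have h := schur_sub_mem (RingHom.ker (rename mergeTimes : BiSeries →ₐ[ℂ] TimeSeries)) _
    (rename_timeDiff a) n
  have hD : ∀ y ∈ (RingHom.ker (rename mergeTimes : BiSeries →ₐ[ℂ] TimeSeries)) ^ 2,
      rename mergeTimes (MvPowerSeries.pderiv ℂ (Sum.inl (b, k)) y) = 0 := by
    intro y hy
    rw [pow_two] at hy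
    induction hy using Submodule.mul_induction_on' with
    | mem_mul_mem u hu v hv =>
      rw [Derivation.leibniz, map_add, smul_eq_mul, smul_eq_mul, map_mul, map_mul,
        (RingHom.mem_ker).1 hu, (RingHom.mem_ker).1 hv, zero_mul, zero_mul, add_zero]
    | add u _ v _ hu hv => rw [map_add, map_add, hu, hv, add_zero]
  have h' := hD _ h
  rw [map_sub, map_sub, sub_eq_zero] at h'
  refine h'.trans ?_
  rw [map_sub, pderiv_X_of_ne Sum.inr_ne_inl, sub_zero, pderiv_X]
  by_cases hab : a = b ∧ (n : ℕ) = k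
  · rw [if_pos hab, hab.1, PNat.coe_injective hab.2, Pi.single_eq_same, map_one]
  · rw [if_neg hab, Pi.single_eq_of_ne, map_zero]
    intro h
    simp only [Sum.inl.injEq, Prod.mk.injEq] at h
    exact hab ⟨h.1, by rw [h.2]⟩

/-- The locally finite sums in the definitions of both residues. -/
def bilinearSum (a : Fin 2) (c : ℕ → ℤ) (f g : TimeSeries) : BiSeries := fun d =>
  ∑ᶠ n : ℕ, coeff d (expCoeff a n *
    wCoeff (c n) (miwaShift Sum.inl a (-1) f * miwaShift Sum.inr a 1 g))

theorem isSumOf_bilinearSum (a : Fin 2) (c : ℕ → ℤ) (f g : TimeSeries) :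
    IsSumOf (bilinearSum a c f g) fun n => expCoeff a n *
      wCoeff (c n) (miwaShift Sum.inl a (-1) f * miwaShift Sum.inr a 1 g) := fun d =>
  ⟨expCoeff_mul_finite a _ d, rfl⟩

theorem rename_wCoeff_miwaShift_mul (a : Fin 2) (n : ℤ) (f g : TimeSeries) :
    rename mergeTimes (wCoeff n (miwaShift Sum.inl a (-1) f * miwaShift Sum.inr a 1 g)) =
      wCoeff n (miwaShift id a (-1) f * miwaShift id a 1 g) := by
  rw [← wCoeff_rename, map_mul, rename_miwaShift _ Sum.inl_injective _ _ _ fun _ => rfl,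
    rename_miwaShift _ Sum.inr_injective _ _ _ fun _ => rfl]

theorem rename_bilinearSum (a : Fin 2) (c : ℕ → ℤ) (f g : TimeSeries) :
    rename mergeTimes (bilinearSum a c f g) =
      wCoeff (c 0) (miwaShift id a (-1) f * miwaShift id a 1 g) := by
  rw [((isSumOf_bilinearSum a c f g).rename mergeTimes).eq_of_single 0 fun n hn => by
    rw [map_mul, rename_expCoeff a n hn, zero_mul]]
  rw [expCoeff_zero, one_mul, rename_wCoeff_miwaShift_mul]

/-- By the Leibniz rule the derivative falls on the left tau function, where only the constant term
of the exponential survives on the diagonal, or on the exponential, where only its `k`-th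
coefficient does. The factor in `t'` is constant for it. -/
theorem rename_pderiv_bilinearSum (a b : Fin 2) (k : ℕ+) (c : ℕ → ℤ) (f g : TimeSeries) :
    rename mergeTimes (pderiv ℂ (Sum.inl (b, k)) (bilinearSum a c f g)) =
      wCoeff (c 0) (miwaShift id a (-1) (pderiv ℂ (b, k) f) * miwaShift id a 1 g) +
      if a = b then wCoeff (c k) (miwaShift id a (-1) f * miwaShift id a 1 g) else 0 := by
  have hD : ∀ n, rename mergeTimes (pderiv ℂ (Sum.inl (b, k)) (expCoeff a n *
      wCoeff (c n) (miwaShift Sum.inl a (-1) f * miwaShift Sum.inr a 1 g))) =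
      (if n = 0 then
        wCoeff (c n) (miwaShift id a (-1) (pderiv ℂ (b, k) f) * miwaShift id a 1 g) else 0) +
      (if a = b ∧ n = k then
        wCoeff (c n) (miwaShift id a (-1) f * miwaShift id a 1 g) else 0) := by
    intro n
    rw [Derivation.leibniz, map_add, smul_eq_mul, smul_eq_mul, map_mul, map_mul,
      rename_pderiv_expCoeff, rename_wCoeff_miwaShift_mul, ← wCoeff_pderiv, Derivation.leibniz,
      smul_eq_mul, smul_eq_mul, pderiv_miwaShift Sum.inl_injective,
      pderiv_miwaShift_of_notMem Sum.inr_injective _ _ (by simp), mul_zero, zero_add,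
      mul_comm (miwaShift Sum.inr a 1 g), rename_wCoeff_miwaShift_mul]
    congr 1
    · split_ifs with h
      · rw [h, expCoeff_zero, map_one, one_mul]
      · rw [rename_expCoeff a n h, zero_mul]
    · split_ifs
      · rw [mul_one]
      · rw [mul_zero]
  have hs := ((isSumOf_bilinearSum a c f g).pderiv (Sum.inl (b, k))).rename mergeTimes
  ext d
  rw [(hs d).2]
  simp only [hD]
  have hk : (0 : ℕ) ≠ k := k.ne_zero.symm
  rw [finsum_eq_sum_of_support_subset (s := {0, (k : ℕ)}) _ fun n hn => ?_, Finset.sum_pair hk]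
  · simp [hk, hk.symm]
  · by_contra h
    simp only [Finset.coe_insert, Finset.coe_singleton, Set.mem_insert_iff,
      Set.mem_singleton_iff, not_or] at h
    simp [h.1, h.2] at hn

/-- This is the restriction of the bilinear equation to `t' = t`, where both exponentials are `1`.
-/
theorem IsTau.wCoeff_eq {τ : ℤ × ℤ → TimeSeries} (hτ : IsTau τ) {m m' : ℤ × ℤ}
    (h : m'.1 - m'.2 ≤ m.1 - m.2) :
    wCoeff (m.1 - m'.1 + 1) (miwaShift id 0 (-1) (τ m) * miwaShift id 0 1 (τ m')) =
      wCoeff (-(m.2 - m'.2) - 1)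
        (miwaShift id 1 (-1) (τ (m + e)) * miwaShift id 1 1 (τ (m' - e))) := by
  have h1 := rename_bilinearSum 0 (fun n => n + (m.1 - m'.1) + 1) (τ m) (τ m')
  have h2 := rename_bilinearSum 1 (fun n => n - (m.2 - m'.2) - 1) (τ (m + e)) (τ (m' - e))
  have h3 := h1.symm.trans ((congrArg (rename mergeTimes) (hτ m m' h)).trans h2)
  simpa using h3

/-- The bilinear equation is differentiated in a time of the left set before `t' = t` is imposed;
the conditional terms come from the exponentials. -/
theorem IsTau.wCoeff_pderiv_eq {τ : ℤ × ℤ → TimeSeries} (hτ : IsTau τ) (b : Fin 2) (k : ℕ+)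
    {m m' : ℤ × ℤ} (h : m'.1 - m'.2 ≤ m.1 - m.2) :
    wCoeff (m.1 - m'.1 + 1)
        (miwaShift id 0 (-1) (pderiv ℂ (b, k) (τ m)) * miwaShift id 0 1 (τ m')) +
      (if b = 0 then wCoeff (m.1 - m'.1 + 1 + k)
        (miwaShift id 0 (-1) (τ m) * miwaShift id 0 1 (τ m')) else 0) =
    wCoeff (-(m.2 - m'.2) - 1) (miwaShift id 1 (-1) (pderiv ℂ (b, k) (τ (m + e))) *
        miwaShift id 1 1 (τ (m' - e))) +
      (if b = 1 then wCoeff (-(m.2 - m'.2) - 1 + k)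
        (miwaShift id 1 (-1) (τ (m + e)) * miwaShift id 1 1 (τ (m' - e))) else 0) := by
  have h1 := rename_pderiv_bilinearSum 0 b k (fun n => n + (m.1 - m'.1) + 1) (τ m) (τ m')
  have h2 := rename_pderiv_bilinearSum 1 b k (fun n => n - (m.2 - m'.2) - 1) (τ (m + e))
    (τ (m' - e))
  have h3 := h1.symm.trans
    ((congrArg (fun G => rename mergeTimes (pderiv ℂ (Sum.inl (b, k)) G)) (hτ m m' h)).trans h2)
  have e1 : m.1 - m'.1 + 1 + k = (k : ℕ) + (m.1 - m'.1) + 1 := by ring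
  have e2 : -(m.2 - m'.2) - 1 + k = (k : ℕ) - (m.2 - m'.2) - 1 := by ring
  rw [e1, e2]
  simpa [eq_comm] using h3

end Diagonal

/-! ## The derivations of the field of fractions -/

theorem exists_eq_div (x : TimeField) : ∃ f g : TimeSeries, g ≠ 0 ∧
    x = algebraMap TimeSeries TimeField f / algebraMap TimeSeries TimeField g := by
  obtain ⟨f, g, hg, rfl⟩ := IsFractionRing.div_surjective (A := TimeSeries) x
  exact ⟨f, g, nonZeroDivisors.ne_zero hg, rfl⟩

theorem algebraMap_time_ne_zero {f : TimeSeries} (hf : f ≠ 0) :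
    algebraMap TimeSeries TimeField f ≠ 0 :=
  (map_ne_zero_iff _ (IsFractionRing.injective TimeSeries TimeField)).2 hf

theorem fracDeriv_algebraMap (s : Time) (f : TimeSeries) :
    fracDeriv s (algebraMap TimeSeries TimeField f) =
      algebraMap TimeSeries TimeField (MvPowerSeries.pderiv ℂ s f) := by
  have h := fracDeriv_div s f 1 one_ne_zero
  simpa using h

theorem fracDeriv_add (s : Time) (x y : TimeField) :
    fracDeriv s (x + y) = fracDeriv s x + fracDeriv s y := by
  obtain ⟨f, g, hg, rfl⟩ := exists_eq_div x
  obtain ⟨f', g', hg', rfl⟩ := exists_eq_div y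
  have h1 := algebraMap_time_ne_zero hg
  have h2 := algebraMap_time_ne_zero hg'
  rw [div_add_div _ _ h1 h2, ← map_mul, ← map_mul, ← map_mul, ← map_add,
    fracDeriv_div s _ _ (mul_ne_zero hg hg'), fracDeriv_div s _ _ hg, fracDeriv_div s _ _ hg']
  simp only [map_add, map_sub, map_mul, map_pow, Derivation.leibniz, smul_eq_mul]
  field_simp
  ring

theorem fracDeriv_mul (s : Time) (x y : TimeField) :
    fracDeriv s (x * y) = fracDeriv s x * y + x * fracDeriv s y := by
  obtain ⟨f, g, hg, rfl⟩ := exists_eq_div x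
  obtain ⟨f', g', hg', rfl⟩ := exists_eq_div y
  have h1 := algebraMap_time_ne_zero hg
  have h2 := algebraMap_time_ne_zero hg'
  rw [div_mul_div_comm, ← map_mul, ← map_mul,
    fracDeriv_div s _ _ (mul_ne_zero hg hg'), fracDeriv_div s _ _ hg, fracDeriv_div s _ _ hg']
  simp only [map_add, map_sub, map_mul, map_pow, Derivation.leibniz, smul_eq_mul]
  field_simp
  ring

/-- `fracDeriv` as an additive map. -/
def fracDerivHom (s : Time) : TimeField →+ TimeField :=
  AddMonoidHom.mk' (fracDeriv s) (fracDeriv_add s)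

@[simp] theorem fracDerivHom_apply (s : Time) (x : TimeField) :
    fracDerivHom s x = fracDeriv s x := rfl

@[simp] theorem fracDeriv_zero (s : Time) : fracDeriv s 0 = 0 := map_zero (fracDerivHom s)

@[simp] theorem fracDeriv_one (s : Time) : fracDeriv s 1 = 0 := by
  have h := fracDeriv_algebraMap s 1
  rwa [map_one, MvPowerSeries.pderiv_one, map_zero] at h

theorem fracDeriv_inv_algebraMap (s : Time) {g : TimeSeries} (hg : g ≠ 0) :
    fracDeriv s (algebraMap TimeSeries TimeField g)⁻¹ =
      -(algebraMap TimeSeries TimeField (MvPowerSeries.pderiv ℂ s g)) *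
        ((algebraMap TimeSeries TimeField g)⁻¹) ^ 2 := by
  have h := fracDeriv_div s 1 g hg
  rw [map_one, one_div] at h
  rw [h, MvPowerSeries.pderiv_one]
  simp [div_eq_mul_inv]

/-! ## The wave functions at the vacuum, as Laurent series -/

section Wave

/-- Coefficientwise passage to the field of fractions. -/
def laurentFrac : LaurentSeries TimeSeries →+* LaurentSeries TimeField where
  toFun x := x.map ((algebraMap TimeSeries TimeField : TimeSeries →+* TimeField) :
    TimeSeries →ₙ+* TimeField)
  map_one' := by 
    ext n
    by_cases h : n = 0
    · simp only [HahnSeries.map_coeff, HahnSeries.coeff_one, h, if_true]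
      exact map_one (algebraMap TimeSeries TimeField)
    · simp [HahnSeries.coeff_one, h]
  map_zero' := by ext; simp
  map_mul' _ _ := HahnSeries.map_mul _
  map_add' _ _ := by ext; simp

@[simp] theorem coeff_laurentFrac (x : LaurentSeries TimeSeries) (n : ℤ) :
    (laurentFrac x).coeff n = algebraMap TimeSeries TimeField (x.coeff n) := rfl

/-- The point of the lattice at which the tau function in the numerator of a wave function is
taken. -/
def numPoint (a : Fin 2) (m : ℤ × ℤ) : ℤ × ℤ := if a = 0 then m else m + e

@[simp] theorem numPoint_zero (m : ℤ × ℤ) : numPoint 0 m = m := rfl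

@[simp] theorem numPoint_one (m : ℤ × ℤ) : numPoint 1 m = m + e := rfl

/-- The same for the dual wave functions. -/
def dualNumPoint (a : Fin 2) (m : ℤ × ℤ) : ℤ × ℤ := if a = 0 then m else m - e

@[simp] theorem dualNumPoint_zero (m : ℤ × ℤ) : dualNumPoint 0 m = m := rfl

@[simp] theorem dualNumPoint_one (m : ℤ × ℤ) : dualNumPoint 1 m = m - e := rfl

variable (τ : ℤ × ℤ → TimeSeries)

/-- The expansion of the quotient in the definition of `S τ a`. -/
def wave (a : Fin 2) (m : ℤ × ℤ) : LaurentSeries TimeField :=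
  HahnSeries.C (algebraMap TimeSeries TimeField (τ m))⁻¹ *
    laurentFrac (wSeries (miwaShift id a (-1) (τ (numPoint a m))))

/-- Division by `τ m` is a matter of symmetry with `wave`; the arguments below use that the order in
`w` is zero. -/
def dualWave (a : Fin 2) (m : ℤ × ℤ) : LaurentSeries TimeField :=
  HahnSeries.C (algebraMap TimeSeries TimeField (τ m))⁻¹ *
    laurentFrac (wSeries (miwaShift id a 1 (τ (dualNumPoint a m))))

/-- The coefficientwise derivative. -/
def laurentDeriv (s : Time) (x : LaurentSeries TimeField) : LaurentSeries TimeField :=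
  x.map (fracDerivHom s)

@[simp] theorem coeff_laurentDeriv (s : Time) (x : LaurentSeries TimeField) (n : ℤ) :
    (laurentDeriv s x).coeff n = fracDeriv s (x.coeff n) := rfl

theorem coeff_wave (a : Fin 2) (m : ℤ × ℤ) (n : ℤ) :
    (wave τ a m).coeff n = algebraMap TimeSeries TimeField
      (wCoeff n (miwaShift id a (-1) (τ (numPoint a m)))) /
        algebraMap TimeSeries TimeField (τ m) := by
  rw [wave, HahnSeries.C_mul_eq_smul, HahnSeries.coeff_smul, coeff_laurentFrac, coeff_wSeries,
    smul_eq_mul, mul_comm, div_eq_mul_inv]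

theorem coeff_dualWave (a : Fin 2) (m : ℤ × ℤ) (n : ℤ) :
    (dualWave τ a m).coeff n = algebraMap TimeSeries TimeField
      (wCoeff n (miwaShift id a 1 (τ (dualNumPoint a m)))) /
        algebraMap TimeSeries TimeField (τ m) := by
  rw [dualWave, HahnSeries.C_mul_eq_smul, HahnSeries.coeff_smul, coeff_laurentFrac,
    coeff_wSeries, smul_eq_mul, mul_comm, div_eq_mul_inv]

/-- The numerator contributes the Miwa shift of its derivative, and the denominator contributes a
multiple of the wave function itself. -/
theorem laurentDeriv_wave {τ : ℤ × ℤ → TimeSeries} (hτ₀ : ∀ m, τ m ≠ 0) (s : Time) (a : Fin 2)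
    (m : ℤ × ℤ) :
    laurentDeriv s (wave τ a m) =
      HahnSeries.C (algebraMap TimeSeries TimeField (τ m))⁻¹ *
        laurentFrac (wSeries (miwaShift id a (-1)
          (MvPowerSeries.pderiv ℂ s (τ (numPoint a m))))) -
      HahnSeries.C (algebraMap TimeSeries TimeField (MvPowerSeries.pderiv ℂ s (τ m)) *
        (algebraMap TimeSeries TimeField (τ m))⁻¹) * wave τ a m := by
  ext n
  rw [coeff_laurentDeriv, HahnSeries.coeff_sub, HahnSeries.C_mul_eq_smul, HahnSeries.C_mul_eq_smul,
    HahnSeries.coeff_smul, HahnSeries.coeff_smul, coeff_wave, coeff_laurentFrac, coeff_wSeries,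
    div_eq_mul_inv, fracDeriv_mul, fracDeriv_inv_algebraMap s (hτ₀ m), fracDeriv_algebraMap,
    ← wCoeff_pderiv]
  have h := pderiv_miwaShift Function.injective_id a (-1) s (τ (numPoint a m))
  simp only [id] at h
  rw [h, smul_eq_mul, smul_eq_mul]
  ring

variable {τ}

theorem coeff_laurentFrac_mul (F G : MvPowerSeries (Option Time) ℂ) (n : ℤ) :
    (laurentFrac (wSeries F) * laurentFrac (wSeries G)).coeff n =
      algebraMap TimeSeries TimeField (wCoeff n (F * G)) := by
  rw [← map_mul, ← wSeries_mul, coeff_laurentFrac, coeff_wSeries]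

theorem coeff_C_mul_mul_C_mul {K : Type} [Field K] (u v : K) (x y : LaurentSeries K) (n : ℤ) :
    ((HahnSeries.C u * x) * (HahnSeries.C v * y)).coeff n = u * v * (x * y).coeff n := by
  rw [mul_mul_mul_comm, ← map_mul, HahnSeries.C_mul_eq_smul, HahnSeries.coeff_smul, smul_eq_mul]

theorem coeff_wave_mul_dualWave (a : Fin 2) (m m' : ℤ × ℤ) (n : ℤ) :
    (wave τ a m * dualWave τ a m').coeff n =
      (algebraMap TimeSeries TimeField (τ m))⁻¹ * (algebraMap TimeSeries TimeField (τ m'))⁻¹ *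
      algebraMap TimeSeries TimeField (wCoeff n (miwaShift id a (-1) (τ (numPoint a m)) *
        miwaShift id a 1 (τ (dualNumPoint a m')))) := by
  rw [wave, dualWave, coeff_C_mul_mul_C_mul, coeff_laurentFrac_mul]

theorem coeff_laurentDeriv_wave_mul_dualWave (hτ₀ : ∀ m, τ m ≠ 0) (s : Time) (a : Fin 2)
    (m m' : ℤ × ℤ) (n : ℤ) :
    (laurentDeriv s (wave τ a m) * dualWave τ a m').coeff n =
      (algebraMap TimeSeries TimeField (τ m))⁻¹ * (algebraMap TimeSeries TimeField (τ m'))⁻¹ *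
      algebraMap TimeSeries TimeField (wCoeff n (miwaShift id a (-1)
        (MvPowerSeries.pderiv ℂ s (τ (numPoint a m))) *
          miwaShift id a 1 (τ (dualNumPoint a m')))) -
      algebraMap TimeSeries TimeField (MvPowerSeries.pderiv ℂ s (τ m)) *
        (algebraMap TimeSeries TimeField (τ m))⁻¹ * (wave τ a m * dualWave τ a m').coeff n := by
  rw [laurentDeriv_wave hτ₀, sub_mul, HahnSeries.coeff_sub, mul_assoc (HahnSeries.C _) (wave τ a m),
    HahnSeries.C_mul_eq_smul (r := _ * _), HahnSeries.coeff_smul, smul_eq_mul, dualWave,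
    coeff_C_mul_mul_C_mul, coeff_laurentFrac_mul]

/-- The bilinear equation at equal times. -/
theorem IsTau.coeff_wave_mul (hτ : IsTau τ) {m m' : ℤ × ℤ} (h : m'.1 - m'.2 ≤ m.1 - m.2) :
    (wave τ 0 m * dualWave τ 0 m').coeff (m.1 - m'.1 + 1) =
      (wave τ 1 m * dualWave τ 1 m').coeff (-(m.2 - m'.2) - 1) := by
  rw [coeff_wave_mul_dualWave, coeff_wave_mul_dualWave]
  exact congrArg _ (congrArg _ (hτ.wCoeff_eq h))

/-- The derivative of the bilinear equation at equal times. -/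
theorem IsTau.coeff_laurentDeriv_wave_mul (hτ : IsTau τ) (hτ₀ : ∀ m, τ m ≠ 0) (b : Fin 2) (k : ℕ+)
    {m m' : ℤ × ℤ} (h : m'.1 - m'.2 ≤ m.1 - m.2) :
    (laurentDeriv (b, k) (wave τ 0 m) * dualWave τ 0 m').coeff (m.1 - m'.1 + 1) +
      (if b = 0 then (wave τ 0 m * dualWave τ 0 m').coeff (m.1 - m'.1 + 1 + k) else 0) =
    (laurentDeriv (b, k) (wave τ 1 m) * dualWave τ 1 m').coeff (-(m.2 - m'.2) - 1) +
      (if b = 1 then (wave τ 1 m * dualWave τ 1 m').coeff (-(m.2 - m'.2) - 1 + k) else 0) := by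
  -- In both components the denominator contributes `∂τ_m / τ_m` times the undifferentiated pairing,
  -- so these contributions agree by `h0`.
  have h0 := hτ.coeff_wave_mul h
  have h1 := congrArg (fun y => (algebraMap TimeSeries TimeField (τ m))⁻¹ *
    (algebraMap TimeSeries TimeField (τ m'))⁻¹ * algebraMap TimeSeries TimeField y)
    (hτ.wCoeff_pderiv_eq b k h)
  simp only [map_add, mul_add, apply_ite (algebraMap TimeSeries TimeField), mul_ite, map_zero,
    mul_zero] at h1
  rw [coeff_laurentDeriv_wave_mul_dualWave hτ₀, coeff_laurentDeriv_wave_mul_dualWave hτ₀, h0,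
    coeff_wave_mul_dualWave 0 m m' (m.1 - m'.1 + 1 + k),
    coeff_wave_mul_dualWave 1 m m' (-(m.2 - m'.2) - 1 + k)]
  simp only [numPoint_zero, numPoint_one, dualNumPoint_zero, dualNumPoint_one]
  linear_combination h1

theorem coeff_wave_of_neg (a : Fin 2) (m : ℤ × ℤ) {n : ℤ} (hn : n < 0) :
    (wave τ a m).coeff n = 0 := by
  rw [coeff_wave, wCoeff_of_neg hn, map_zero, zero_div]

theorem coeff_wave_zero (a : Fin 2) (m : ℤ × ℤ) :
    (wave τ a m).coeff 0 = algebraMap TimeSeries TimeField (τ (numPoint a m)) /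
      algebraMap TimeSeries TimeField (τ m) := by
  rw [coeff_wave, wCoeff_zero_miwaShift]

theorem coeff_dualWave_of_neg (a : Fin 2) (m : ℤ × ℤ) {n : ℤ} (hn : n < 0) :
    (dualWave τ a m).coeff n = 0 := by
  rw [coeff_dualWave, wCoeff_of_neg hn, map_zero, zero_div]

theorem coeff_dualWave_zero_ne_zero (hτ₀ : ∀ m, τ m ≠ 0) (a : Fin 2) (m : ℤ × ℤ) :
    (dualWave τ a m).coeff 0 ≠ 0 := by
  rw [coeff_dualWave, wCoeff_zero_miwaShift]
  exact div_ne_zero (algebraMap_time_ne_zero (hτ₀ _)) (algebraMap_time_ne_zero (hτ₀ _))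

theorem order_dualWave (hτ₀ : ∀ m, τ m ≠ 0) (a : Fin 2) (m : ℤ × ℤ) :
    (dualWave τ a m).order = 0 := by
  have h := coeff_dualWave_zero_ne_zero hτ₀ a m
  refine le_antisymm (HahnSeries.order_le_of_coeff_ne_zero h) ?_
  by_contra! hlt
  have hne : dualWave τ a m ≠ 0 := fun h0 => h (by rw [h0, HahnSeries.coeff_zero])
  exact HahnSeries.coeff_order_eq_zero.not.2 hne (coeff_dualWave_of_neg a m hlt)

/-- If the residue pairings of `X` and `Y` with all the dual wave functions in the domain of the
bilinear equation agree, and `X`, `Y` have complementary orders, then both vanish. -/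
theorem eq_zero_of_pairing (hτ₀ : ∀ m, τ m ≠ 0) (m : ℤ × ℤ) (c : ℤ)
    (X Y : LaurentSeries TimeField) (hX : ∀ n < 1 - c, X.coeff n = 0)
    (hY : ∀ n < c, Y.coeff n = 0)
    (h : ∀ m' : ℤ × ℤ, m'.1 - m'.2 ≤ m.1 - m.2 →
      (X * dualWave τ 0 m').coeff (m.1 - m'.1 + 1) =
        (Y * dualWave τ 1 m').coeff (-(m.2 - m'.2) - 1)) : X = 0 ∧ Y = 0 := by
  have hlow : ∀ (Z : LaurentSeries TimeField) (a : Fin 2) (m' : ℤ × ℤ) (d n : ℤ),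
      (∀ n < d, Z.coeff n = 0) → n < d → (Z * dualWave τ a m').coeff n = 0 := by
    intro Z a m' d n hZ hn
    rw [HahnSeries.coeff_mul]
    refine Finset.sum_eq_zero fun x hx => ?_
    have hx' := (Finset.mem_antidiagonal.1 hx).2.2
    rcases lt_or_ge x.1 d with h1 | h1
    · rw [hZ _ h1, zero_mul]
    · rw [coeff_dualWave_of_neg a m' (by omega), mul_zero]
  have hord : ∀ (Z : LaurentSeries TimeField) (a : Fin 2) (d : ℤ), Z ≠ 0 →
      (∀ n < d, Z.coeff n = 0) → d ≤ Z.order ∧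
        ∀ m', (Z * dualWave τ a m').coeff Z.order ≠ 0 := by
    intro Z a d hZ0 hZ
    refine ⟨?_, fun m' => ?_⟩
    · by_contra! hlt
      exact HahnSeries.coeff_order_eq_zero.not.2 hZ0 (hZ _ hlt)
    · have h1 := HahnSeries.coeff_mul_order_add_order Z (dualWave τ a m')
      rw [order_dualWave hτ₀, add_zero] at h1
      rw [h1]
      have hne : dualWave τ a m' ≠ 0 := fun h0 =>
        coeff_dualWave_zero_ne_zero hτ₀ a m' (by rw [h0, HahnSeries.coeff_zero])
      exact mul_ne_zero (HahnSeries.leadingCoeff_ne_zero.2 hZ0)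
        (HahnSeries.leadingCoeff_ne_zero.2 hne)
  have hX0 : X = 0 := by
    by_contra hne
    obtain ⟨h1, h2⟩ := hord X 0 _ hne hX
    -- For this `m'` the left pairing reads the coefficient of index `X.order`, and the right one
    -- that of index `c - 1`, below the order of `Y`. The point is admissible exactly because `1 - c
    -- ≤ X.order`.
    apply h2 (m.1 - (X.order - 1), m.2 + c)
    have h3 := h (m.1 - (X.order - 1), m.2 + c) (by dsimp only; omega)
    rw [hlow Y 1 _ c _ hY (by dsimp only; omega)] at h3
    convert h3 using 2
    dsimp only
    ring
  refine ⟨hX0, ?_⟩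
  by_contra hne
  obtain ⟨-, h2⟩ := hord Y 1 _ hne hY
  -- Diagonal shifts keep `m₁ - m₂` and are always admissible; this one makes the right pairing read
  -- the leading coefficient.
  apply h2 (m.1 + (Y.order + 1), m.2 + (Y.order + 1))
  have h3 := h (m.1 + (Y.order + 1), m.2 + (Y.order + 1)) (by dsimp only; omega)
  rw [hX0, zero_mul, HahnSeries.coeff_zero] at h3
  refine Eq.trans ?_ h3.symm
  congr 1
  dsimp only
  ring

end Wave

namespace Op

/-! ## The rings `E a` -/

@[simp] theorem zero_apply (k m : ℤ × ℤ) : (0 : Op) k m = 0 := rfl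
@[simp] theorem add_apply (A B : Op) (k m : ℤ × ℤ) : (A + B) k m = A k m + B k m := rfl
@[simp] theorem sub_apply (A B : Op) (k m : ℤ × ℤ) : (A - B) k m = A k m - B k m := rfl

theorem ext' {A B : Op} (h : ∀ k m, A k m = B k m) : A = B :=
  funext fun k => funext fun m => h k m

/-- The degree of `Λ ^ k`, for which `E a` consists of Laurent series: in `Λ₁⁻¹` for `a = 0`, in
`Λ₂` for `a = 1`. -/
def deg (a : Fin 2) (k : ℤ × ℤ) : ℤ := if a = 0 then -k.1 else k.2

/-- The degree of `Λ ^ k` in the other shift. -/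
def codeg (a : Fin 2) (k : ℤ × ℤ) : ℤ := if a = 0 then k.2 else k.1

theorem deg_add (a : Fin 2) (k l : ℤ × ℤ) : deg a (k + l) = deg a k + deg a l := by
  unfold deg; split_ifs <;> simp [add_comm]

theorem deg_sub (a : Fin 2) (k l : ℤ × ℤ) : deg a (k - l) = deg a k - deg a l := by
  unfold deg; split_ifs <;> simp; ring

theorem deg_zero (a : Fin 2) : deg a 0 = 0 := by
  unfold deg; split_ifs <;> simp

theorem codeg_add (a : Fin 2) (k l : ℤ × ℤ) : codeg a (k + l) = codeg a k + codeg a l := by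
  unfold codeg; split_ifs <;> simp

theorem codeg_sub (a : Fin 2) (k l : ℤ × ℤ) : codeg a (k - l) = codeg a k - codeg a l := by
  unfold codeg; split_ifs <;> simp

theorem codeg_zero (a : Fin 2) : codeg a 0 = 0 := by
  unfold codeg; split_ifs <;> simp

theorem eq_of_deg_eq {a : Fin 2} {k l : ℤ × ℤ} (h : deg a k = deg a l)
    (h' : codeg a k = codeg a l) : k = l := by
  unfold deg at h; unfold codeg at h'
  split_ifs at h h' <;> ext <;> first | assumption | omega

/-- A single finiteness condition encodes both the bound on the support and the finiteness in the
other shift, so that the two rings can be treated uniformly. -/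
theorem mem_E_iff {a : Fin 2} {A : Op} :
    A ∈ E a ↔ ∀ N : ℤ, {k : ℤ × ℤ | deg a k ≤ N ∧ A k ≠ 0}.Finite := by
  fin_cases a
  · change ((∃ M : ℤ, ∀ k : ℤ × ℤ, M < k.1 → A k = 0) ∧ ∀ i : ℤ, {j : ℤ | A (i, j) ≠ 0}.Finite) ↔
      ∀ N : ℤ, {k : ℤ × ℤ | -k.1 ≤ N ∧ A k ≠ 0}.Finite
    constructor
    · rintro ⟨⟨M, hM⟩, hf⟩ N
      refine ((Set.finite_Icc (-N) M).biUnion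
        fun i _ => (hf i).image fun j => (i, j)).subset fun k hk => ?_
      refine Set.mem_biUnion (x := k.1) ⟨by linarith [hk.1], ?_⟩ ⟨k.2, hk.2, rfl⟩
      exact not_lt.1 fun h => hk.2 (hM k h)
    · intro h
      refine ⟨?_, fun i => ?_⟩
      · obtain ⟨M, hM⟩ := ((h 0).image Prod.fst).bddAbove
        refine ⟨max M 0, fun k hk => ?_⟩
        by_contra hne
        have := hM ⟨k, ⟨by have := le_max_right M 0; linarith, hne⟩, rfl⟩
        exact absurd (lt_of_le_of_lt (le_max_left M 0) hk) (not_lt.2 this)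
      · exact ((h (-i)).image Prod.snd).subset fun j hj => ⟨(i, j), ⟨le_rfl, hj⟩, rfl⟩
  · change ((∃ M : ℤ, ∀ k : ℤ × ℤ, k.2 < M → A k = 0) ∧ ∀ j : ℤ, {i : ℤ | A (i, j) ≠ 0}.Finite) ↔
      ∀ N : ℤ, {k : ℤ × ℤ | k.2 ≤ N ∧ A k ≠ 0}.Finite
    constructor
    · rintro ⟨⟨M, hM⟩, hf⟩ N
      refine ((Set.finite_Icc M N).biUnion
        fun j _ => (hf j).image fun i => (i, j)).subset fun k hk => ?_
      refine Set.mem_biUnion (x := k.2) ⟨?_, hk.1⟩ ⟨k.1, hk.2, rfl⟩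
      exact not_lt.1 fun h => hk.2 (hM k h)
    · intro h
      refine ⟨?_, fun j => ?_⟩
      · obtain ⟨M, hM⟩ := ((h 0).image Prod.snd).bddBelow
        refine ⟨min M 0, fun k hk => ?_⟩
        by_contra hne
        have := hM ⟨k, ⟨by have := min_le_right M 0; linarith, hne⟩, rfl⟩
        exact absurd (lt_of_lt_of_le hk (min_le_left M 0)) (not_lt.2 this)
      · exact ((h j).image Prod.fst).subset fun i hi => ⟨(i, j), ⟨le_rfl, hi⟩, rfl⟩

theorem exists_deg_bound {a : Fin 2} {A : Op} (hA : A ∈ E a) :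
    ∃ M : ℤ, ∀ k : ℤ × ℤ, A k ≠ 0 → M ≤ deg a k := by
  obtain ⟨M, hM⟩ := ((mem_E_iff.1 hA 0).image (deg a)).bddBelow
  refine ⟨min M 0, fun k hk => ?_⟩
  rcases le_or_gt (deg a k) 0 with h | h
  · exact (min_le_left _ _).trans (hM ⟨k, ⟨h, hk⟩, rfl⟩)
  · exact (min_le_right _ _).trans h.le

theorem mem_E_of_finite (a : Fin 2) {A : Op} (h : {k | A k ≠ 0}.Finite) : A ∈ E a :=
  mem_E_iff.2 fun _ => h.subset fun _ hk => hk.2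

theorem mem_E_of_imp {a : Fin 2} {A B : Op} (hB : B ∈ E a) (h : ∀ k, A k ≠ 0 → B k ≠ 0) :
    A ∈ E a :=
  mem_E_iff.2 fun N => (mem_E_iff.1 hB N).subset fun _ hk => ⟨hk.1, h _ hk.2⟩

theorem lam_mem_E (a : Fin 2) (v : ℤ × ℤ) : lam v ∈ E a := by
  refine mem_E_of_finite a ((Set.finite_singleton v).subset fun k hk => ?_)
  by_contra hne
  exact hk (funext fun m => if_neg hne)

theorem fn_mem_E (a : Fin 2) (f : ℤ × ℤ → TimeField) : fn f ∈ E a := by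
  refine mem_E_of_finite a ((Set.finite_singleton 0).subset fun k hk => ?_)
  by_contra hne
  exact hk (funext fun m => if_neg hne)

theorem mul_mem_E {a : Fin 2} {A B : Op} (hA : A ∈ E a) (hB : B ∈ E a) : A * B ∈ E a := by
  obtain ⟨M, hM⟩ := exists_deg_bound hA
  obtain ⟨M', hM'⟩ := exists_deg_bound hB
  refine mem_E_iff.2 fun N => (Set.Finite.image2 (· + ·) (mem_E_iff.1 hA (N - M'))
    (mem_E_iff.1 hB (N - M))).subset fun k hk => ?_
  obtain ⟨m, hm⟩ := Function.ne_iff.1 hk.2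
  obtain ⟨i, hi⟩ : ∃ i, A i m * B (k - i) (m + i) ≠ 0 := by
    by_contra! h
    exact hm (finsum_eq_zero_of_forall_eq_zero h)
  have hAi : A i ≠ 0 := fun h => hi (by rw [h]; exact zero_mul _)
  have hBi : B (k - i) ≠ 0 := fun h => hi (by rw [h]; exact mul_zero _)
  have h1 := hM i hAi
  have h2 := hM' _ hBi
  have h3 := deg_sub a k i
  have h4 := hk.1
  exact ⟨i, ⟨by linarith, hAi⟩, k - i, ⟨by linarith, hBi⟩, add_sub_cancel i k⟩

/-- `E a` as a group. -/
def addSubgroupE (a : Fin 2) : AddSubgroup Op where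
  carrier := E a
  zero_mem' := mem_E_of_finite a (Set.finite_empty.subset fun _ hk => hk rfl)
  add_mem' {A B} hA hB := mem_E_iff.2 fun N =>
    ((mem_E_iff.1 hA N).union (mem_E_iff.1 hB N)).subset fun k hk => by
      by_cases h : A k = 0
      · refine Or.inr ⟨hk.1, fun h' => hk.2 ?_⟩
        change A k + B k = 0
        rw [h, h', add_zero]
      · exact Or.inl ⟨hk.1, h⟩
  neg_mem' {A} hA := mem_E_of_imp hA fun _ hk h => hk (by change -A _ = 0; rw [h, neg_zero])

/-- `E a` as a type; it is a ring. -/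
abbrev RingE (a : Fin 2) : Type := addSubgroupE a

theorem mul_assoc_of_mem {a : Fin 2} {A B C : Op} (hA : A ∈ E a) (hB : B ∈ E a) (hC : C ∈ E a) :
    A * B * C = A * (B * C) := by
  refine ext' fun k m => ?_
  obtain ⟨M, hM⟩ := exists_deg_bound hA
  obtain ⟨M', hM'⟩ := exists_deg_bound hB
  obtain ⟨M'', hM''⟩ := exists_deg_bound hC
  let F : (ℤ × ℤ) × (ℤ × ℤ) → TimeField := fun p =>
    A p.1 m * (B p.2 (m + p.1) * C (k - p.1 - p.2) (m + p.1 + p.2))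
  have hF : F.HasFiniteSupport := by
    refine ((mem_E_iff.1 hA (deg a k - M' - M'')).prod
      (mem_E_iff.1 hB (deg a k - M - M''))).subset fun p hp => ?_
    have h1 : A p.1 ≠ 0 := fun h => hp (by simp [F, h])
    have h2 : B p.2 ≠ 0 := fun h => hp (by simp [F, h])
    have h3 : C (k - p.1 - p.2) ≠ 0 := fun h => hp (by simp [F, h])
    have h1' := hM _ h1
    have h2' := hM' _ h2
    have h3' := hM'' _ h3
    rw [deg_sub, deg_sub] at h3'
    exact ⟨⟨by linarith, h1⟩, ⟨by linarith, h2⟩⟩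
  -- From the exponents of `A * B` and of `A` to those of `A` and of `B`.
  let σ : (ℤ × ℤ) × (ℤ × ℤ) ≃ (ℤ × ℤ) × (ℤ × ℤ) :=
    { toFun := fun p => (p.2, p.1 - p.2)
      invFun := fun p => (p.1 + p.2, p.1)
      left_inv := fun p => by ext <;> simp
      right_inv := fun p => by ext <;> simp }
  have hσ : (F ∘ σ).HasFiniteSupport := by
    refine (Set.Finite.preimage σ.injective.injOn hF).subset fun p hp => hp
  have hl : (A * (B * C)) k m = ∑ᶠ p, F p := by
    rw [finsum_curry _ hF, mul_apply]
    refine finsum_congr fun i => ?_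
    rw [mul_apply, mul_finsum]
  rw [hl, ← finsum_comp_equiv σ, finsum_curry (fun p => F (σ p)) hσ, mul_apply]
  refine finsum_congr fun i => ?_
  rw [mul_apply, finsum_mul]
  refine finsum_congr fun j => ?_
  change A j m * B (i - j) (m + j) * C (k - i) (m + i) =
    A j m * (B (i - j) (m + j) * C (k - j - (i - j)) (m + j + (i - j)))
  rw [mul_assoc, show k - j - (i - j) = k - i by abel, show m + j + (i - j) = m + i by abel]

theorem lam_mul (v : ℤ × ℤ) (A : Op) (k m : ℤ × ℤ) : (lam v * A) k m = A (k - v) (m + v) := by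
  rw [mul_apply, finsum_eq_single _ v fun i hi => by simp [lam, hi]]
  simp [lam]

theorem mul_lam (v : ℤ × ℤ) (A : Op) (k m : ℤ × ℤ) : (A * lam v) k m = A (k - v) m := by
  rw [mul_apply, finsum_eq_single _ (k - v) fun i hi => ?_]
  · simp [lam]
  · have : k - i ≠ v := fun h => hi (by rw [← h]; abel)
    simp [lam, this]

theorem fn_mul (f : ℤ × ℤ → TimeField) (A : Op) (k m : ℤ × ℤ) : (fn f * A) k m = f m * A k m := by
  rw [mul_apply, finsum_eq_single _ 0 fun i hi => by simp [fn, hi]]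
  simp [fn]

theorem one_eq_lam : (1 : Op) = lam 0 := rfl

theorem one_apply (k m : ℤ × ℤ) : (1 : Op) k m = if k = 0 then 1 else 0 := rfl

theorem mul_add_of_mem {a : Fin 2} {A B C : Op} (hA : A ∈ E a) (hB : B ∈ E a) (hC : C ∈ E a) :
    A * (B + C) = A * B + A * C := by
  refine ext' fun k m => ?_
  rw [add_apply, mul_apply, mul_apply, mul_apply,
    ← finsum_add_distrib (mul_finite a hA hB k m) (mul_finite a hA hC k m)]
  exact finsum_congr fun i => mul_add _ _ _

theorem add_mul_of_mem {a : Fin 2} {A B C : Op} (hA : A ∈ E a) (hB : B ∈ E a) (hC : C ∈ E a) :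
    (A + B) * C = A * C + B * C := by
  refine ext' fun k m => ?_
  rw [add_apply, mul_apply, mul_apply, mul_apply,
    ← finsum_add_distrib (mul_finite a hA hC k m) (mul_finite a hB hC k m)]
  exact finsum_congr fun i => add_mul _ _ _

/-- The ring laws rely on finite sums inside one fixed `E a`. In `Op` at large an infinite sum in a
product has the default value `0`. -/
instance (a : Fin 2) : Ring (RingE a) :=
  { (inferInstance : AddCommGroup (RingE a)) with
    mul := fun A B => ⟨A.1 * B.1, mul_mem_E A.2 B.2⟩
    one := ⟨1, lam_mem_E a 0⟩
    mul_assoc := fun A B C => Subtype.ext (mul_assoc_of_mem A.2 B.2 C.2)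
    one_mul := fun A => Subtype.ext (ext' fun k m => by
      change (lam 0 * A.1) k m = A.1 k m
      rw [lam_mul, sub_zero, add_zero])
    mul_one := fun A => Subtype.ext (ext' fun k m => by
      change (A.1 * lam 0) k m = A.1 k m
      rw [mul_lam, sub_zero])
    zero_mul := fun A => Subtype.ext (ext' fun k m => by
      change ((0 : Op) * A.1) k m = 0
      simp [mul_apply])
    mul_zero := fun A => Subtype.ext (ext' fun k m => by
      change (A.1 * (0 : Op)) k m = 0
      simp [mul_apply])
    left_distrib := fun A B C => Subtype.ext (mul_add_of_mem A.2 B.2 C.2)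
    right_distrib := fun A B C => Subtype.ext (add_mul_of_mem A.2 B.2 C.2) }

section Coe

variable {a : Fin 2}

@[simp] theorem coe_mul (A B : RingE a) : ((A * B : RingE a) : Op) = (A : Op) * (B : Op) := rfl

@[simp] theorem coe_pow (A : RingE a) (n : ℕ) : ((A ^ n : RingE a) : Op) = npow (A : Op) n := by
  induction n with
  | zero => rw [pow_zero]; rfl
  | succ n ih => rw [pow_succ, coe_mul, ih]; rfl

end Coe

/-! ### Shifts and derivatives of the coefficients -/

theorem shift_mul (v : ℤ × ℤ) (A B : Op) : shift v (A * B) = shift v A * shift v B := by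
  refine ext' fun k m => ?_
  change (A * B) k (m + v) = _
  rw [mul_apply, mul_apply]
  refine finsum_congr fun i => ?_
  change _ = A i (m + v) * B (k - i) (m + i + v)
  rw [add_right_comm]

theorem shift_mem_E {a : Fin 2} (v : ℤ × ℤ) {A : Op} (hA : A ∈ E a) : shift v A ∈ E a :=
  mem_E_of_imp hA fun _ hk h => hk (funext fun m => congrFun h (m + v))

theorem shift_shift (v w : ℤ × ℤ) (A : Op) : shift v (shift w A) = shift (v + w) A :=
  ext' fun k m => by
    change A k (m + v + w) = A k (m + (v + w))
    rw [add_assoc]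

theorem lam_mul_eq_shift_mul (v : ℤ × ℤ) (A : Op) : lam v * A = shift v A * lam v :=
  ext' fun k m => by rw [lam_mul, mul_lam]; rfl

theorem lam_mul_lam (v w : ℤ × ℤ) : lam v * lam w = lam (v + w) := ext' fun k m => by
  rw [lam_mul]
  simp [lam, sub_eq_iff_eq_add, add_comm]

theorem deriv_mem_E {a : Fin 2} (s : Time) {A : Op} (hA : A ∈ E a) : Op.deriv s A ∈ E a :=
  mem_E_of_imp hA fun k hk h => hk (funext fun m => by
    change fracDeriv s (A k m) = 0
    rw [h]
    exact fracDeriv_zero s)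

theorem deriv_apply (s : Time) (A : Op) (k m : ℤ × ℤ) :
    Op.deriv s A k m = fracDeriv s (A k m) := rfl

theorem deriv_add (s : Time) (A B : Op) : Op.deriv s (A + B) = Op.deriv s A + Op.deriv s B :=
  ext' fun _ _ => fracDeriv_add s _ _

theorem deriv_mul {a : Fin 2} (s : Time) {A B : Op} (hA : A ∈ E a) (hB : B ∈ E a) :
    Op.deriv s (A * B) = Op.deriv s A * B + A * Op.deriv s B := by
  refine ext' fun k m => ?_
  have h1 := mul_finite a hA hB k m
  rw [add_apply, deriv_apply, mul_apply, mul_apply, mul_apply,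
    ← finsum_add_distrib (mul_finite a (deriv_mem_E s hA) hB k m)
      (mul_finite a hA (deriv_mem_E s hB) k m), ← fracDerivHom_apply,
    AddMonoidHom.map_finsum _ h1]
  exact finsum_congr fun i => fracDeriv_mul s _ _

theorem deriv_lam (s : Time) (v : ℤ × ℤ) : Op.deriv s (lam v) = 0 := ext' fun k m => by
  rw [deriv_apply]
  unfold lam
  split_ifs
  · exact fracDeriv_one s
  · exact fracDeriv_zero s

/-! ## Laurent series in one shift, and their inverses -/

theorem mem_E₀_iff {a : Fin 2} {A : Op} :
    A ∈ E₀ a ↔ A ∈ E a ∧ ∀ k, codeg a k ≠ 0 → A k = 0 := by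
  fin_cases a <;> exact Iff.rfl

theorem mul_mem_E₀ {a : Fin 2} {A B : Op} (hA : A ∈ E₀ a) (hB : B ∈ E₀ a) : A * B ∈ E₀ a := by
  rw [mem_E₀_iff] at *
  refine ⟨mul_mem_E hA.1 hB.1, fun k hk => funext fun m => ?_⟩
  refine finsum_eq_zero_of_forall_eq_zero fun i => ?_
  by_cases hi : codeg a i = 0
  · rw [hB.2 (k - i) (by rwa [codeg_sub, hi, sub_zero])]
    exact mul_zero _
  · rw [hA.2 i hi]
    exact zero_mul _

theorem add_mem_E₀ {a : Fin 2} {A B : Op} (hA : A ∈ E₀ a) (hB : B ∈ E₀ a) : A + B ∈ E₀ a := by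
  rw [mem_E₀_iff] at *
  refine ⟨(addSubgroupE a).add_mem hA.1 hB.1, fun k hk => ?_⟩
  change A k + B k = 0
  rw [hA.2 k hk, hB.2 k hk, add_zero]

theorem sub_mem_E₀ {a : Fin 2} {A B : Op} (hA : A ∈ E₀ a) (hB : B ∈ E₀ a) : A - B ∈ E₀ a := by
  rw [mem_E₀_iff] at *
  refine ⟨(addSubgroupE a).sub_mem hA.1 hB.1, fun k hk => ?_⟩
  change A k - B k = 0
  rw [hA.2 k hk, hB.2 k hk, sub_zero]

theorem lam_mem_E₀ {a : Fin 2} {v : ℤ × ℤ} (hv : codeg a v = 0) : lam v ∈ E₀ a :=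
  mem_E₀_iff.2 ⟨lam_mem_E a v, fun k hk => funext fun m => if_neg fun h => hk (by rw [h, hv])⟩

theorem one_mem_E₀ (a : Fin 2) : (1 : Op) ∈ E₀ a := lam_mem_E₀ (codeg_zero a)

theorem fn_mem_E₀ (a : Fin 2) (f : ℤ × ℤ → TimeField) : fn f ∈ E₀ a :=
  mem_E₀_iff.2 ⟨fn_mem_E a f, fun k hk => funext fun m =>
    if_neg fun h => hk (by rw [h, codeg_zero])⟩

theorem shift_mem_E₀ {a : Fin 2} (v : ℤ × ℤ) {A : Op} (hA : A ∈ E₀ a) : shift v A ∈ E₀ a := by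
  rw [mem_E₀_iff] at *
  exact ⟨shift_mem_E v hA.1, fun k hk => funext fun m => congrFun (hA.2 k hk) (m + v)⟩

theorem deriv_mem_E₀ {a : Fin 2} (s : Time) {A : Op} (hA : A ∈ E₀ a) : Op.deriv s A ∈ E₀ a := by
  rw [mem_E₀_iff] at *
  refine ⟨deriv_mem_E s hA.1, fun k hk => funext fun m => ?_⟩
  rw [deriv_apply, hA.2 k hk]
  exact fracDeriv_zero s

theorem npow_mem_E₀ {a : Fin 2} {A : Op} (hA : A ∈ E₀ a) (n : ℕ) : npow A n ∈ E₀ a := by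
  induction n with
  | zero => exact one_mem_E₀ a
  | succ n ih => exact mul_mem_E₀ ih hA

theorem E₀_subset_E {a : Fin 2} {A : Op} (hA : A ∈ E₀ a) : A ∈ E a := (mem_E₀_iff.1 hA).1

/-- The exponent of degree `i` and codegree `0`. -/
def ax (a : Fin 2) (i : ℤ) : ℤ × ℤ := if a = 0 then (-i, 0) else (0, i)

@[simp] theorem deg_ax (a : Fin 2) (i : ℤ) : deg a (ax a i) = i := by
  unfold deg ax; split_ifs <;> simp

@[simp] theorem codeg_ax (a : Fin 2) (i : ℤ) : codeg a (ax a i) = 0 := by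
  unfold codeg ax; split_ifs <;> simp

theorem ax_deg {a : Fin 2} {k : ℤ × ℤ} (hk : codeg a k = 0) : ax a (deg a k) = k :=
  eq_of_deg_eq (deg_ax a _) (by rw [codeg_ax, hk])

theorem ax_zero (a : Fin 2) : ax a 0 = 0 := by
  unfold ax; split_ifs <;> simp

theorem ax_injective (a : Fin 2) : Function.Injective (ax a) := fun i j h => by
  rw [← deg_ax a i, h, deg_ax]

/-- Invertible power series in `Λ₁⁻¹` (`a = 0`) or `Λ₂` (`a = 1`). -/
def IsUnitSeries (a : Fin 2) (A : Op) : Prop :=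
  A ∈ E₀ a ∧ (∀ k, deg a k < 0 → A k = 0) ∧ ∀ m, A 0 m ≠ 0

/-- The coefficients of `A * R = 1` form a triangular system, solved recursively by division by the
leading coefficient of `A`; the arguments are shifted because `Λ` moves the lattice point. -/
theorem IsUnitSeries.exists_right_inv {a : Fin 2} {A : Op} (hA : IsUnitSeries a A) :
    ∃ R, IsUnitSeries a R ∧ A * R = 1 := by
  obtain ⟨hE, hneg, h0⟩ := hA
  have hco := (mem_E₀_iff.1 hE).2
  let r : ℕ → ℤ × ℤ → TimeField := fun n =>
    Nat.strongRecOn (motive := fun _ => ℤ × ℤ → TimeField) n fun n ih m =>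
    (A 0 m)⁻¹ * ((if n = 0 then 1 else 0) - ∑ i : Fin n,
      A (ax a (i + 1)) m * ih (n - 1 - i) (by omega) (m + ax a (i + 1)))
  have hr : ∀ n m, r n m = (A 0 m)⁻¹ * ((if n = 0 then 1 else 0) - ∑ i : Fin n,
      A (ax a (i + 1)) m * r (n - 1 - i) (m + ax a (i + 1))) := by
    intro n m
    change Nat.strongRecOn (motive := fun _ => ℤ × ℤ → TimeField) n _ m = _
    rw [Nat.strongRecOn_eq]
  let R : Op := fun k m => if codeg a k = 0 ∧ 0 ≤ deg a k then r (deg a k).toNat m else 0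
  have hRneg : ∀ k, deg a k < 0 → R k = 0 := fun k hk => funext fun m =>
    if_neg fun h => absurd h.2 (not_le.2 hk)
  have hRco : ∀ k, codeg a k ≠ 0 → R k = 0 := fun k hk => funext fun m => if_neg fun h => hk h.1
  have hRE : R ∈ E₀ a := by
    refine mem_E₀_iff.2 ⟨mem_E_iff.2 fun N => ?_, hRco⟩
    refine ((Set.finite_Icc 0 N).image (ax a)).subset fun k hk => ?_
    have h1 : codeg a k = 0 := by
      by_contra h
      exact hk.2 (hRco k h)
    have h2 : 0 ≤ deg a k := by
      by_contra! h
      exact hk.2 (hRneg k h)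
    exact ⟨deg a k, ⟨h2, hk.1⟩, ax_deg h1⟩
  have hRax : ∀ (n : ℕ) m, R (ax a n) m = r n m := fun n m => by
    change (if codeg a (ax a n) = 0 ∧ 0 ≤ deg a (ax a n) then _ else _) = _
    rw [if_pos (by simp), deg_ax, Int.toNat_natCast]
  refine ⟨R, ⟨hRE, hRneg, fun m => ?_⟩, ?_⟩
  · have h := hRax 0 m
    rw [hr, Nat.cast_zero, ax_zero] at h
    rw [h]
    simpa using h0 m
  · refine ext' fun k m => ?_
    rw [one_apply]
    by_cases hk : codeg a k = 0
    swap
    · rw [(mem_E₀_iff.1 (mul_mem_E₀ hE hRE)).2 k hk, if_neg fun h => hk (by rw [h, codeg_zero])]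
      rfl
    rcases lt_or_ge (deg a k) 0 with hd | hd
    · rw [if_neg fun h => by rw [h, deg_zero] at hd; exact hd.false, mul_apply]
      refine finsum_eq_zero_of_forall_eq_zero fun i => ?_
      rcases lt_or_ge (deg a i) 0 with hi | hi
      · rw [hneg i hi]
        exact zero_mul _
      · rw [hRneg (k - i) (by rw [deg_sub]; omega)]
        exact mul_zero _
    · obtain ⟨n, hn⟩ := Int.eq_ofNat_of_zero_le hd
      have hk' : k = ax a n := by rw [← hn, ax_deg hk]
      have hsub : ∀ i : ℤ, k - ax a i = ax a (n - i) := fun i =>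
        eq_of_deg_eq (a := a) (by rw [deg_sub, hn, deg_ax, deg_ax])
          (by rw [codeg_sub, hk, codeg_ax, codeg_ax, sub_zero])
      rw [mul_apply, finsum_eq_sum_of_support_subset
        (s := (Finset.range (n + 1)).image fun i : ℕ => ax a i) _ fun i hi => ?_,
        Finset.sum_image fun i _ j _ h => by exact_mod_cast ax_injective a h,
        Finset.sum_range_succ']
      · have h1 : ∀ i ∈ Finset.range n, A (ax a ((i + 1 : ℕ) : ℤ)) m *
            R (k - ax a ((i + 1 : ℕ) : ℤ)) (m + ax a ((i + 1 : ℕ) : ℤ)) =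
            A (ax a (i + 1)) m * r (n - 1 - i) (m + ax a (i + 1)) := by
          intro i hi
          have hi' := Finset.mem_range.1 hi
          rw [hsub, show (n : ℤ) - ((i + 1 : ℕ) : ℤ) = ((n - 1 - i : ℕ) : ℤ) by omega, hRax]
          push_cast
          rfl
        rw [Finset.sum_congr rfl h1, Nat.cast_zero, ax_zero, sub_zero, add_zero, hk', hRax, hr,
          mul_inv_cancel_left₀ (h0 m), Finset.sum_range, add_sub_cancel]
        refine if_congr ?_ rfl rfl
        rw [← ax_zero a, (ax_injective a).eq_iff, Nat.cast_eq_zero]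
      · have hAi : A i ≠ 0 := fun h => hi (by change A i m * _ = 0; rw [h]; exact zero_mul _)
        have hRi : R (k - i) ≠ 0 := fun h => hi (by change A i m * _ = 0; rw [h]; exact mul_zero _)
        have h1 : codeg a i = 0 := by
          by_contra h
          exact hAi (hco i h)
        have h2 : 0 ≤ deg a i := by
          by_contra! h
          exact hAi (hneg i h)
        have h3 : 0 ≤ deg a (k - i) := by
          by_contra! h
          exact hRi (hRneg _ h)
        rw [deg_sub, hn] at h3
        rw [Finset.coe_image]
        refine ⟨(deg a i).toNat, ?_, ?_⟩
        · rw [Finset.coe_range, Set.mem_Iio]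
          omega
        · change ax a ((deg a i).toNat : ℤ) = i
          rw [Int.toNat_of_nonneg h2, ax_deg h1]

/-- The right inverse is again a unit series and has a right inverse of its own, which associativity
identifies with `A`. -/
theorem IsUnitSeries.inv_spec {a : Fin 2} {A : Op} (hA : IsUnitSeries a A) :
    inv a A ∈ E₀ a ∧ A * inv a A = 1 ∧ inv a A * A = 1 := by
  have h : ∃ B ∈ E₀ a, A * B = 1 ∧ B * A = 1 := by
    obtain ⟨R, hR, hAR⟩ := hA.exists_right_inv
    obtain ⟨R', hR', hRR'⟩ := hR.exists_right_inv
    refine ⟨R, hR.1, hAR, ?_⟩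
    let A' : RingE a := ⟨A, E₀_subset_E hA.1⟩
    let B' : RingE a := ⟨R, E₀_subset_E hR.1⟩
    let C' : RingE a := ⟨R', E₀_subset_E hR'.1⟩
    have h1 : A' * B' = 1 := Subtype.ext hAR
    have h2 : B' * C' = 1 := Subtype.ext hRR'
    have h3 : A' = C' := by
      calc A' = A' * (B' * C') := by rw [h2, mul_one]
        _ = C' := by rw [← mul_assoc, h1, one_mul]
    have h4 : B' * A' = 1 := by rw [h3, h2]
    exact congrArg Subtype.val h4
  unfold inv
  rw [dif_pos h]
  exact h.choose_spec

/-! ## The action on the vacuum -/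

/-- The shift that acts trivially on the vacuum. -/
def trans (a : Fin 2) : ℤ × ℤ := if a = 0 then e₂ else e₁

@[simp] theorem deg_zsmul_trans (a : Fin 2) (j : ℤ) : deg a (j • trans a) = 0 := by
  unfold deg trans; split_ifs <;> simp [e₁, e₂]

@[simp] theorem codeg_zsmul_trans (a : Fin 2) (j : ℤ) : codeg a (j • trans a) = j := by
  unfold codeg trans; split_ifs <;> simp [e₁, e₂]

theorem add_zsmul_trans_injective (a : Fin 2) (k : ℤ × ℤ) :
    Function.Injective fun j : ℤ => k + j • trans a := fun i j h => by
  have := congrArg (codeg a) (add_left_cancel h)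
  rwa [codeg_zsmul_trans, codeg_zsmul_trans] at this

/-- The sum of the coefficients along a line of exponents of the same degree: the coefficient of
the operator that is obtained by setting the shift `trans a` to `1`. -/
def lineSum (a : Fin 2) (A : Op) (k m : ℤ × ℤ) : TimeField := ∑ᶠ j : ℤ, A (k + j • trans a) m

theorem lineSum_finite {a : Fin 2} {A : Op} (hA : A ∈ E a) (k m : ℤ × ℤ) :
    (fun j : ℤ => A (k + j • trans a) m).HasFiniteSupport := by
  refine ((mem_E_iff.1 hA (deg a k)).preimage
    (add_zsmul_trans_injective a k).injOn).subset fun j hj => ⟨?_, fun h => hj ?_⟩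
  · rw [deg_add, deg_zsmul_trans, add_zero]
  · change A (k + j • trans a) m = 0
    rw [h]
    rfl

theorem lineSum_add {a : Fin 2} {A B : Op} (hA : A ∈ E a) (hB : B ∈ E a) (k m : ℤ × ℤ) :
    lineSum a (A + B) k m = lineSum a A k m + lineSum a B k m :=
  finsum_add_distrib (lineSum_finite hA k m) (lineSum_finite hB k m)

theorem lineSum_sub {a : Fin 2} {A B : Op} (hA : A ∈ E a) (hB : B ∈ E a) (k m : ℤ × ℤ) :
    lineSum a (A - B) k m = lineSum a A k m - lineSum a B k m :=
  finsum_sub_distrib (lineSum_finite hA k m) (lineSum_finite hB k m)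

theorem lineSum_add_zsmul (a : Fin 2) (A : Op) (k m : ℤ × ℤ) (c : ℤ) :
    lineSum a A (k + c • trans a) m = lineSum a A k m := by
  unfold lineSum
  rw [← finsum_comp_equiv (Equiv.addLeft c) (f := fun j => A (k + j • trans a) m)]
  refine finsum_congr fun j => ?_
  rw [Equiv.coe_addLeft, add_smul, add_assoc]

theorem lineSum_of_mem_E₀ {a : Fin 2} {A : Op} (hA : A ∈ E₀ a) {k : ℤ × ℤ} (hk : codeg a k = 0)
    (m : ℤ × ℤ) : lineSum a A k m = A k m := by
  unfold lineSum
  rw [finsum_eq_single _ 0 fun j hj => ?_, zero_smul, add_zero]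
  rw [(mem_E₀_iff.1 hA).2 _ (by rwa [codeg_add, hk, codeg_zsmul_trans, zero_add])]
  rfl

/-- The right factor enters only through its value on the vacuum, because it acts first. This makes
the annihilator of the vacuum a left ideal. -/
theorem lineSum_mul {a : Fin 2} {A B : Op} (hA : A ∈ E a) (hB : B ∈ E a) (k m : ℤ × ℤ) :
    lineSum a (A * B) k m = ∑ᶠ i, A i m * lineSum a B (k - i) (m + i) := by
  obtain ⟨M, hM⟩ := exists_deg_bound hA
  obtain ⟨M', hM'⟩ := exists_deg_bound hB
  let F : (ℤ × ℤ) × ℤ → TimeField := fun p =>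
    A p.1 m * B (k - p.1 + p.2 • trans a) (m + p.1)
  have hF : F.HasFiniteSupport := by
    have hinj : Function.Injective fun p : (ℤ × ℤ) × ℤ => (p.1, k - p.1 + p.2 • trans a) := by
      rintro ⟨i, j⟩ ⟨i', j'⟩ h
      simp only [Prod.mk.injEq] at h
      obtain ⟨rfl, h⟩ := h
      rw [add_zsmul_trans_injective a _ h]
    refine (((mem_E_iff.1 hA (deg a k - M')).prod
      (mem_E_iff.1 hB (deg a k - M))).preimage hinj.injOn).subset fun p hp => ?_
    have h1 : A p.1 ≠ 0 := fun h => hp (by simp [F, h])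
    have h2 : B (k - p.1 + p.2 • trans a) ≠ 0 := fun h => hp (by
      change A p.1 m * B (k - p.1 + p.2 • trans a) (m + p.1) = 0
      rw [h]
      exact mul_zero _)
    have h1' := hM _ h1
    have h2' := hM' _ h2
    rw [deg_add, deg_sub, deg_zsmul_trans] at h2'
    refine ⟨⟨?_, h1⟩, ⟨?_, h2⟩⟩
    · change deg a p.1 ≤ _
      linarith
    · change deg a (k - p.1 + p.2 • trans a) ≤ _
      rw [deg_add, deg_sub, deg_zsmul_trans]
      linarith
  have hF' : (fun p : ℤ × (ℤ × ℤ) => F p.swap).HasFiniteSupport :=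
    (Set.Finite.preimage Prod.swap_injective.injOn hF).subset fun p hp => hp
  have hr : ∑ᶠ i, A i m * lineSum a B (k - i) (m + i) = ∑ᶠ p, F p := by
    rw [finsum_curry _ hF]
    refine finsum_congr fun i => ?_
    rw [lineSum, mul_finsum]
  rw [hr, ← finsum_comp_equiv (Equiv.prodComm ℤ (ℤ × ℤ)), lineSum]
  refine Eq.trans ?_ (finsum_curry _ hF').symm
  refine finsum_congr fun j => ?_
  rw [mul_apply]
  refine finsum_congr fun i => ?_
  change _ = A i m * B (k - i + j • trans a) (m + i)
  rw [add_sub_right_comm]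

theorem lineSum_mul_eq_zero {a : Fin 2} {A B : Op} (hA : A ∈ E a) (hB : B ∈ E a)
    (h : ∀ k m, lineSum a B k m = 0) (k m : ℤ × ℤ) : lineSum a (A * B) k m = 0 := by
  rw [lineSum_mul hA hB]
  exact finsum_eq_zero_of_forall_eq_zero fun i => by rw [h, mul_zero]

theorem lineSum_mul_lam (a : Fin 2) (A : Op) (v k m : ℤ × ℤ) :
    lineSum a (A * lam v) k m = lineSum a A (k - v) m :=
  finsum_congr fun j => by rw [mul_lam, add_sub_right_comm]

theorem lineSum_deriv {a : Fin 2} (s : Time) {A : Op} (hA : A ∈ E a) (k m : ℤ × ℤ) :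
    lineSum a (Op.deriv s A) k m = fracDeriv s (lineSum a A k m) := by
  rw [lineSum, lineSum, ← fracDerivHom_apply, AddMonoidHom.map_finsum _ (lineSum_finite hA k m)]
  rfl

/-- Along each line of exponents an element of `E₀ a` has at most one nonzero coefficient, so no
cancellation can occur. -/
theorem eq_zero_of_lineSum {a : Fin 2} {A : Op} (hA : A ∈ E₀ a)
    (h : ∀ k m, lineSum a A k m = 0) : A = 0 := by
  refine ext' fun k m => ?_
  by_cases hk : codeg a k = 0
  · rw [← lineSum_of_mem_E₀ hA hk, h]
    rfl
  · rw [(mem_E₀_iff.1 hA).2 k hk]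
    rfl

/-- The operator in one shift with the same action on the vacuum. -/
def vac (a : Fin 2) (A : Op) : Op := fun k m => if codeg a k = 0 then lineSum a A k m else 0

theorem vac_mem_E₀ {a : Fin 2} {A : Op} (hA : A ∈ E a) : vac a A ∈ E₀ a := by
  have hco : ∀ k, codeg a k ≠ 0 → vac a A k = 0 := fun k hk => funext fun m => if_neg hk
  refine mem_E₀_iff.2 ⟨mem_E_iff.2 fun N => ?_, hco⟩
  refine ((mem_E_iff.1 hA N).image fun k => ax a (deg a k)).subset fun k hk => ?_
  obtain ⟨m, hm⟩ := Function.ne_iff.1 hk.2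
  have hk0 : codeg a k = 0 := by
    by_contra h
    exact hk.2 (hco k h)
  obtain ⟨j, hj⟩ : ∃ j : ℤ, A (k + j • trans a) m ≠ 0 := by
    by_contra! h
    exact hm ((if_pos hk0).trans (finsum_eq_zero_of_forall_eq_zero h))
  have hd : deg a (k + j • trans a) = deg a k := by rw [deg_add, deg_zsmul_trans, add_zero]
  refine ⟨k + j • trans a, ⟨hd.trans_le hk.1, fun h => hj (by rw [h]; rfl)⟩, ?_⟩
  change ax a (deg a (k + j • trans a)) = k
  rw [hd, ax_deg hk0]

theorem lineSum_vac {a : Fin 2} {A : Op} (hA : A ∈ E a) (k m : ℤ × ℤ) :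
    lineSum a (vac a A) k m = lineSum a A k m := by
  rw [← lineSum_add_zsmul a _ k m (-codeg a k), ← lineSum_add_zsmul a A k m (-codeg a k)]
  have h : codeg a (k + (-codeg a k) • trans a) = 0 := by
    rw [codeg_add, codeg_zsmul_trans, add_neg_cancel]
  rw [lineSum_of_mem_E₀ (vac_mem_E₀ hA) h]
  exact if_pos h

/-- An operator that annihilates the vacuum is divisible by the difference operator of the shift
that acts trivially. -/
theorem exists_eq_mul_of_lineSum {a : Fin 2} {A : Op} (hA : A ∈ E a)
    (h : ∀ k m, lineSum a A k m = 0) : ∃ Q ∈ E a, A = Q * (lam (trans a) - 1) := by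
  -- Division by the shift minus `1` is summation: each coefficient of `Q` is a tail of the line of
  -- coefficients of `A`, and the product telescopes.
  let Q : Op := fun k m => ∑ᶠ j : ℤ, if 1 ≤ j then A (k + j • trans a) m else 0
  have hfin : ∀ (k m : ℤ × ℤ) (c : ℤ),
      (fun j : ℤ => if c ≤ j then A (k + j • trans a) m else 0).HasFiniteSupport := fun k m c =>
    (lineSum_finite hA k m).subset fun j hj h0 => hj (by
      change (if c ≤ j then A (k + j • trans a) m else 0) = 0
      rw [show A (k + j • trans a) m = 0 from h0, ite_self])
  have hQ : Q ∈ E a := by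
    refine mem_E_iff.2 fun N => ?_
    have hF := mem_E_iff.1 hA N
    obtain ⟨c₁, hc₁⟩ := (hF.image (codeg a)).bddAbove
    obtain ⟨c₀, hc₀⟩ := (hF.image (codeg a)).bddBelow
    refine (Set.Finite.image2 (fun x c => x + (c - codeg a x) • trans a) hF
      (Set.finite_Icc c₀ c₁)).subset fun k hk => ?_
    obtain ⟨m, hm⟩ := Function.ne_iff.1 hk.2
    have hmem : ∀ j : ℤ, A (k + j • trans a) m ≠ 0 →
        k + j • trans a ∈ {x | deg a x ≤ N ∧ A x ≠ 0} := fun j hj =>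
      ⟨by rw [deg_add, deg_zsmul_trans, add_zero]; exact hk.1, fun h => hj (by rw [h]; rfl)⟩
    obtain ⟨j₁, hj₁, hA₁⟩ : ∃ j : ℤ, 1 ≤ j ∧ A (k + j • trans a) m ≠ 0 := by
      by_contra! hno
      refine hm (finsum_eq_zero_of_forall_eq_zero fun j => ?_)
      split_ifs with hj
      · exact hno j hj
      · rfl
    -- As the whole line sums to zero, a nonzero tail forces a nonzero coefficient on the other side
    -- too. This confines the support of `Q` between exponents of `A`.
    obtain ⟨j₀, hj₀, hA₀⟩ : ∃ j : ℤ, j < 1 ∧ A (k + j • trans a) m ≠ 0 := by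
      by_contra! hno
      refine hm ((finsum_congr fun j => ?_).trans (h k m))
      split_ifs with hj
      · rfl
      · exact (hno j (not_le.1 hj)).symm
    have h₁ := hc₁ ⟨_, hmem j₁ hA₁, rfl⟩
    have h₀ := hc₀ ⟨_, hmem j₀ hA₀, rfl⟩
    rw [codeg_add, codeg_zsmul_trans] at h₁ h₀
    refine ⟨_, hmem j₀ hA₀, codeg a k, ⟨by omega, by omega⟩, ?_⟩
    change k + j₀ • trans a + (codeg a k - codeg a (k + j₀ • trans a)) • trans a = k
    rw [codeg_add, codeg_zsmul_trans, add_assoc, ← add_smul]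
    simp
  refine ⟨Q, hQ, ?_⟩
  let Q' : RingE a := ⟨Q, hQ⟩
  let T' : RingE a := ⟨lam (trans a), lam_mem_E a _⟩
  have hmul : Q * (lam (trans a) - 1) = Q * lam (trans a) - Q :=
    congrArg Subtype.val (show Q' * (T' - 1) = Q' * T' - Q' by rw [mul_sub, mul_one])
  rw [hmul]
  refine ext' fun k m => ?_
  rw [sub_apply, mul_lam]
  have h1 : Q (k - trans a) m = ∑ᶠ j : ℤ, if 0 ≤ j then A (k + j • trans a) m else 0 := by
    change ∑ᶠ j : ℤ, (if 1 ≤ j then A (k - trans a + j • trans a) m else 0) = _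
    rw [← finsum_comp_equiv (Equiv.addRight (1 : ℤ))]
    refine finsum_congr fun j => ?_
    rw [Equiv.coe_addRight, add_smul, one_smul]
    refine if_congr (by dsimp only; omega) ?_ rfl
    congr 1
    abel
  rw [h1, show Q k m = ∑ᶠ j : ℤ, if 1 ≤ j then A (k + j • trans a) m else 0 from rfl,
    ← finsum_sub_distrib (hfin k m 0) (hfin k m 1), finsum_eq_single _ 0 fun j hj => ?_]
  · simp
  · by_cases h2 : 0 ≤ j
    · rw [if_pos h2, if_pos (by omega), sub_self]
    · rw [if_neg h2, if_neg (by omega), sub_zero]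

end Op

open Op

namespace Op

/-! ## The left ideal of operators that annihilate the vacuum -/

/-- The operators in `E a` that annihilate the vacuum. -/
def vacuumIdeal (a : Fin 2) : Ideal (RingE a) where
  carrier := {A | ∀ k m, lineSum a A.1 k m = 0}
  zero_mem' _ _ := finsum_zero
  add_mem' {A B} hA hB k m :=
    (lineSum_add A.2 B.2 k m).trans (by rw [hA k m, hB k m, add_zero])
  smul_mem' A B hB k m := lineSum_mul_eq_zero A.2 B.2 hB k m

variable {a : Fin 2}

/-- `Λ ^ v` as an element of `E a`. -/
def lamE (a : Fin 2) (v : ℤ × ℤ) : RingE a := ⟨lam v, lam_mem_E a v⟩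

def fnE (a : Fin 2) (f : ℤ × ℤ → TimeField) : RingE a := ⟨fn f, fn_mem_E a f⟩

def shiftE (v : ℤ × ℤ) (A : RingE a) : RingE a := ⟨shift v A.1, shift_mem_E v A.2⟩

def derivE (s : Time) (A : RingE a) : RingE a := ⟨Op.deriv s A.1, deriv_mem_E s A.2⟩

theorem derivE_mul (s : Time) (A B : RingE a) :
    derivE s (A * B) = derivE s A * B + A * derivE s B := Subtype.ext (deriv_mul s A.2 B.2)

theorem derivE_lamE (s : Time) (v : ℤ × ℤ) : derivE s (lamE a v) = 0 :=
  Subtype.ext (deriv_lam s v)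

theorem lamE_mul (v : ℤ × ℤ) (A : RingE a) : lamE a v * A = shiftE v A * lamE a v :=
  Subtype.ext (lam_mul_eq_shift_mul v A.1)

theorem lamE_mul_lamE (v w : ℤ × ℤ) : lamE a v * lamE a w = lamE a (v + w) :=
  Subtype.ext (lam_mul_lam v w)

theorem lamE_zero : lamE a 0 = 1 := rfl

theorem shiftE_mul (v : ℤ × ℤ) (A B : RingE a) : shiftE v (A * B) = shiftE v A * shiftE v B :=
  Subtype.ext (shift_mul v A.1 B.1)

theorem lamE_pow (v : ℤ × ℤ) (n : ℕ) : lamE a v ^ n = lamE a (n • v) := by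
  induction n with
  | zero => rw [pow_zero, zero_smul, lamE_zero]
  | succ n ih => rw [pow_succ, ih, lamE_mul_lamE, succ_nsmul]

/-- Right multiplication by a pure shift only translates the exponents, so the left ideal is stable
under it. -/
theorem mul_lamE_mem_vacuumIdeal {A : RingE a} (hA : A ∈ vacuumIdeal a) (v : ℤ × ℤ) :
    A * lamE a v ∈ vacuumIdeal a := fun k m =>
  (lineSum_mul_lam a A.1 v k m).trans (hA _ m)

theorem derivE_mem_vacuumIdeal {A : RingE a} (hA : A ∈ vacuumIdeal a) (s : Time) :
    derivE s A ∈ vacuumIdeal a := fun k m =>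
  (lineSum_deriv s A.2 k m).trans (by rw [hA k m, fracDeriv_zero])

theorem eq_zero_of_mem_vacuumIdeal {A : RingE a} (hA : A ∈ vacuumIdeal a) (hA₀ : A.1 ∈ E₀ a) :
    A = 0 := Subtype.ext (eq_zero_of_lineSum hA₀ hA)

theorem exists_eq_mul_of_mem_vacuumIdeal {A : RingE a} (hA : A ∈ vacuumIdeal a) :
    ∃ Q : RingE a, A = Q * (lamE a (trans a) - 1) := by
  obtain ⟨Q, hQ, h⟩ := exists_eq_mul_of_lineSum A.2 hA
  exact ⟨⟨Q, hQ⟩, Subtype.ext h⟩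

theorem lamE_trans_sub_one_mem : lamE a (trans a) - 1 ∈ vacuumIdeal a := fun k m => by
  refine (lineSum_sub (lam_mem_E a _) (lam_mem_E a 0) k m).trans ?_
  have h := lineSum_mul_lam a 1 (trans a) k m
  have h1 : (1 : Op) * lam (trans a) = lam (trans a) := by
    rw [one_eq_lam, lam_mul_lam, zero_add]
  rw [h1] at h
  have h2 := lineSum_add_zsmul a 1 k m (-1)
  rw [neg_one_zsmul, ← sub_eq_add_neg] at h2
  rw [h, h2]
  exact sub_self _

/-- Every operator is congruent to its value on the vacuum, which lies in `E₀ a`. -/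
theorem sub_vac_mem (A : RingE a) :
    A - ⟨vac a A.1, E₀_subset_E (vac_mem_E₀ A.2)⟩ ∈ vacuumIdeal a := fun k m => by
  refine (lineSum_sub A.2 (E₀_subset_E (vac_mem_E₀ A.2)) k m).trans ?_
  rw [lineSum_vac A.2, sub_self]

end Op

/-! ## The operators of a tau function -/

section Operators

variable (τ : ℤ × ℤ → TimeSeries)

theorem S_apply (a : Fin 2) (k m : ℤ × ℤ) :
    S τ a k m = if codeg a k = 0 then (wave τ a m).coeff (deg a k) else 0 := by
  fin_cases a
  · change (if k.2 = 0 then _ else _) = if k.2 = 0 then (wave τ 0 m).coeff (-k.1) else 0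
    rw [coeff_wave]
    rfl
  · change (if k.1 = 0 then _ else _) = if k.1 = 0 then (wave τ 1 m).coeff k.2 else 0
    rw [coeff_wave]
    rfl

theorem S_mem_E₀ (a : Fin 2) : S τ a ∈ E₀ a := by
  refine mem_E₀_iff.2 ⟨mem_E_iff.2 fun N => ?_, fun k hk => funext fun m => ?_⟩
  · refine ((Set.finite_Icc 0 N).image (ax a)).subset fun k hk => ?_
    obtain ⟨m, hm⟩ := Function.ne_iff.1 hk.2
    rw [S_apply] at hm
    have h1 : codeg a k = 0 := by
      by_contra h
      exact hm (if_neg h)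
    rw [if_pos h1] at hm
    have h2 : 0 ≤ deg a k := by
      by_contra! h
      exact hm (coeff_wave_of_neg a m h)
    exact ⟨deg a k, ⟨h2, hk.1⟩, ax_deg h1⟩
  · rw [S_apply, if_neg hk]
    rfl

theorem S_of_deg_neg (a : Fin 2) {k : ℤ × ℤ} (hk : deg a k < 0) : S τ a k = 0 :=
  funext fun m => by
    rw [S_apply, coeff_wave_of_neg a m hk, ite_self]
    rfl

theorem lineSum_S (a : Fin 2) (k m : ℤ × ℤ) :
    lineSum a (S τ a) k m = (wave τ a m).coeff (deg a k) := by
  have h : codeg a (k + (-codeg a k) • trans a) = 0 := by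
    rw [codeg_add, codeg_zsmul_trans, add_neg_cancel]
  rw [← lineSum_add_zsmul a _ k m (-codeg a k), lineSum_of_mem_E₀ (S_mem_E₀ τ a) h, S_apply,
    if_pos h, deg_add, deg_zsmul_trans, add_zero]

def SE (a : Fin 2) : RingE a := ⟨S τ a, E₀_subset_E (S_mem_E₀ τ a)⟩

theorem H_mem_E (a : Fin 2) : H τ ∈ E a :=
  (addSubgroupE a).add_mem (mul_mem_E (lam_mem_E a _)
    ((addSubgroupE a).sub_mem (lam_mem_E a _) (lam_mem_E a 0))) (fn_mem_E a _)

def HE (a : Fin 2) : RingE a := ⟨H τ, H_mem_E τ a⟩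

theorem HE_eq (a : Fin 2) : HE τ a = lamE a e₁ * lamE a e₂ - lamE a e₁ + fnE a (ρ τ) := by
  have h : HE τ a = lamE a e₁ * (lamE a e₂ - 1) + fnE a (ρ τ) := rfl
  rw [h, mul_sub, mul_one]

variable {τ}

theorem isUnitSeries_S (hτ₀ : ∀ m, τ m ≠ 0) (a : Fin 2) : IsUnitSeries a (S τ a) := by
  refine ⟨S_mem_E₀ τ a, fun k hk => S_of_deg_neg τ a hk, fun m => ?_⟩
  rw [S_apply, codeg_zero, if_pos rfl, deg_zero, coeff_wave_zero]
  exact div_ne_zero (algebraMap_time_ne_zero (hτ₀ _)) (algebraMap_time_ne_zero (hτ₀ _))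

theorem Sinv_spec (hτ₀ : ∀ m, τ m ≠ 0) (a : Fin 2) :
    Sinv τ a ∈ E₀ a ∧ S τ a * Sinv τ a = 1 ∧ Sinv τ a * S τ a = 1 :=
  (isUnitSeries_S hτ₀ a).inv_spec

def SinvE (hτ₀ : ∀ m, τ m ≠ 0) (a : Fin 2) : RingE a :=
  ⟨Sinv τ a, E₀_subset_E (Sinv_spec hτ₀ a).1⟩

theorem SE_mul_SinvE (hτ₀ : ∀ m, τ m ≠ 0) (a : Fin 2) : SE τ a * SinvE hτ₀ a = 1 :=
  Subtype.ext (Sinv_spec hτ₀ a).2.1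

theorem SinvE_mul_SE (hτ₀ : ∀ m, τ m ≠ 0) (a : Fin 2) : SinvE hτ₀ a * SE τ a = 1 :=
  Subtype.ext (Sinv_spec hτ₀ a).2.2

theorem mul_SE_right_cancel (hτ₀ : ∀ m, τ m ≠ 0) {a : Fin 2} {A A' : RingE a}
    (h : A * SE τ a = A' * SE τ a) : A = A' := by
  have := congrArg (· * SinvE hτ₀ a) h
  simpa only [mul_assoc, SE_mul_SinvE, mul_one] using this

theorem L_eq (a : Fin 2) : L τ a = S τ a * lam (ax a (-1)) * Sinv τ a := by
  fin_cases a <;> rfl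

theorem L_mem_E₀ (hτ₀ : ∀ m, τ m ≠ 0) (a : Fin 2) : L τ a ∈ E₀ a := by
  rw [L_eq]
  exact mul_mem_E₀ (mul_mem_E₀ (S_mem_E₀ τ a) (lam_mem_E₀ (codeg_ax a _))) (Sinv_spec hτ₀ a).1

def LE (hτ₀ : ∀ m, τ m ≠ 0) (a : Fin 2) : RingE a := ⟨L τ a, E₀_subset_E (L_mem_E₀ hτ₀ a)⟩

theorem LE_mul_SE (hτ₀ : ∀ m, τ m ≠ 0) (a : Fin 2) :
    LE hτ₀ a * SE τ a = SE τ a * lamE a (ax a (-1)) := by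
  have h : LE hτ₀ a = SE τ a * lamE a (ax a (-1)) * SinvE hτ₀ a := Subtype.ext (L_eq a)
  rw [h, mul_assoc, SinvE_mul_SE, mul_one]

theorem LE_pow_mul_SE (hτ₀ : ∀ m, τ m ≠ 0) (a : Fin 2) (n : ℕ) :
    LE hτ₀ a ^ n * SE τ a = SE τ a * lamE a (ax a (-1)) ^ n := by
  induction n with
  | zero => simp
  | succ n ih => rw [pow_succ, mul_assoc, LE_mul_SE, ← mul_assoc, ih, mul_assoc, ← pow_succ]

theorem ρ_ne_zero (hτ₀ : ∀ m, τ m ≠ 0) (m : ℤ × ℤ) : ρ τ m ≠ 0 := by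
  unfold ρ
  have h := fun m => algebraMap_time_ne_zero (hτ₀ m)
  exact mul_ne_zero (div_ne_zero (h _) (h _)) (div_ne_zero (h _) (h _))

/-- An element of `E₀ a` whose product with the wave operator annihilates the vacuum is zero. -/
theorem eq_zero_of_mul_SE_mem (hτ₀ : ∀ m, τ m ≠ 0) {a : Fin 2} {A : RingE a} (hA : A.1 ∈ E₀ a)
    (h : A * SE τ a ∈ vacuumIdeal a) : A = 0 := by
  refine mul_SE_right_cancel hτ₀ ?_
  rw [zero_mul]
  exact eq_zero_of_mem_vacuumIdeal h (mul_mem_E₀ hA (S_mem_E₀ τ a))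

/-! ### Division by `H` -/

/-- Up to an invertible factor, `H S` is the operator whose left multiples annihilate the
vacuum. -/
theorem exists_left_inv_mul (hτ₀ : ∀ m, τ m ≠ 0) {a : Fin 2}
    (hH : HE τ a * SE τ a ∈ vacuumIdeal a) :
    ∃ V : RingE a, V * (HE τ a * SE τ a) = lamE a (trans a) - 1 := by
  -- Modulo the ideal the shift `trans a` is `1`, so `X + Y` annihilates the vacuum; lying in `E₀
  -- a`, it is zero.
  have key : ∀ X Y : RingE a, X.1 ∈ E₀ a → Y.1 ∈ E₀ a →
      HE τ a * SE τ a = X * lamE a (trans a) + Y → Y = -X := by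
    intro X Y hX hY h
    have h1 : X + Y ∈ vacuumIdeal a := by
      have h2 := (vacuumIdeal a).sub_mem hH
        ((vacuumIdeal a).mul_mem_left X lamE_trans_sub_one_mem)
      rw [h] at h2
      convert h2 using 1
      noncomm_ring
    exact (neg_eq_of_add_eq_zero_right (eq_zero_of_mem_vacuumIdeal h1 (add_mem_E₀ hX hY))).symm
  have hS := S_mem_E₀ τ a
  fin_cases a
  · have h := HE_eq τ 0
    have h1 : HE τ 0 * SE τ 0 = shiftE (e₁ + e₂) (SE τ 0) * lamE 0 e₁ * lamE 0 (trans 0) +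
        (fnE 0 (ρ τ) * SE τ 0 - shiftE e₁ (SE τ 0) * lamE 0 e₁) := by
      rw [h, add_mul, sub_mul, lamE_mul_lamE, lamE_mul, lamE_mul, mul_assoc (shiftE _ _) _ _,
        show trans 0 = e₂ from rfl, lamE_mul_lamE]
      abel
    have h2 := key _ _ ?_ ?_ h1
    -- Here `H S₁ = S₁(m + e) Λ₁ (Λ₂ - 1)`, and the left factor is visibly invertible.
    · refine ⟨lamE 0 (-e₁) * shiftE (e₁ + e₂) (SinvE hτ₀ 0), ?_⟩
      have h3 : lamE 0 (-e₁) * shiftE (e₁ + e₂) (SinvE hτ₀ 0) *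
          (shiftE (e₁ + e₂) (SE τ 0) * lamE 0 e₁) = 1 := by
        rw [mul_assoc, ← mul_assoc (shiftE _ _), ← shiftE_mul, SinvE_mul_SE]
        change lamE 0 (-e₁) * (1 * lamE 0 e₁) = 1
        rw [one_mul, lamE_mul_lamE, neg_add_cancel, lamE_zero]
      change _ * (HE τ 0 * SE τ 0) = lamE 0 (trans 0) - 1
      rw [h1, h2, ← sub_eq_add_neg, mul_sub, ← mul_assoc, h3, one_mul]
    · exact mul_mem_E₀ (shift_mem_E₀ _ hS) (lam_mem_E₀ rfl)
    · exact sub_mem_E₀ (mul_mem_E₀ (fn_mem_E₀ _ _) hS)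
        (mul_mem_E₀ (shift_mem_E₀ _ hS) (lam_mem_E₀ rfl))
  · have h := HE_eq τ 1
    have h1 : HE τ 1 * SE τ 1 =
        (shiftE (e₁ + e₂) (SE τ 1) * lamE 1 e₂ - shiftE e₁ (SE τ 1)) * lamE 1 (trans 1) +
        fnE 1 (ρ τ) * SE τ 1 := by
      rw [h, add_mul, sub_mul, lamE_mul_lamE, lamE_mul, lamE_mul, sub_mul,
        mul_assoc (shiftE _ _) _ _, show trans 1 = e₁ from rfl, lamE_mul_lamE, add_comm e₂]
    have h2 := key _ _ ?_ ?_ h1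
    -- Here the coefficient of `Λ₁` is a difference, but it equals `-ρ S₂`, the form in which it can
    -- be inverted.
    · refine ⟨-(SinvE hτ₀ 1 * fnE 1 fun m => (ρ τ m)⁻¹), ?_⟩
      have h3 : -(SinvE hτ₀ 1 * fnE 1 fun m => (ρ τ m)⁻¹) * (fnE 1 (ρ τ) * SE τ 1) = -1 := by
        have h4 : (fnE 1 fun m => (ρ τ m)⁻¹) * fnE 1 (ρ τ) = 1 := Subtype.ext (ext' fun k m => by
          change (fn (fun m => (ρ τ m)⁻¹) * fn (ρ τ)) k m = if k = 0 then 1 else 0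
          rw [fn_mul]
          unfold fn
          split_ifs
          · exact inv_mul_cancel₀ (ρ_ne_zero hτ₀ m)
          · exact mul_zero _)
        rw [neg_mul, mul_assoc, ← mul_assoc (fnE _ _), h4, one_mul, SinvE_mul_SE]
      change _ * (HE τ 1 * SE τ 1) = lamE 1 (trans 1) - 1
      rw [h1, ← neg_eq_iff_eq_neg.2 h2, mul_add, h3, ← mul_assoc, mul_neg, h3, neg_neg, one_mul,
        sub_eq_add_neg]
    · exact sub_mem_E₀ (mul_mem_E₀ (shift_mem_E₀ _ hS) (lam_mem_E₀ rfl)) (shift_mem_E₀ _ hS)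
    · exact mul_mem_E₀ (fn_mem_E₀ _ _) hS

/-- Right multiplication by `S` turns the left ideal of `H` into the vacuum ideal. So the component
of `A` is the value of `A S` on the vacuum, multiplied by `S⁻¹`; uniqueness is the faithfulness of
`E₀ a` on the wave function. -/
theorem existsUnique_isProj (hτ₀ : ∀ m, τ m ≠ 0) {a : Fin 2}
    (hH : HE τ a * SE τ a ∈ vacuumIdeal a) {A : Op} (hA : A ∈ E a) :
    ∃! P : Op, IsProj a (H τ) A P := by
  obtain ⟨V, hV⟩ := exists_left_inv_mul hτ₀ hH
  let A' : RingE a := ⟨A, hA⟩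
  let P₁ : RingE a := ⟨vac a (A * S τ a), E₀_subset_E (vac_mem_E₀ (A' * SE τ a).2)⟩
  let P : RingE a := P₁ * SinvE hτ₀ a
  have hPS : P * SE τ a = P₁ := by rw [mul_assoc, SinvE_mul_SE, mul_one]
  have hmem : (A' - P) * SE τ a ∈ vacuumIdeal a := by
    rw [sub_mul, hPS]
    exact sub_vac_mem (A' * SE τ a)
  obtain ⟨Q, hQ⟩ := exists_eq_mul_of_mem_vacuumIdeal hmem
  have hQ' : A' = P + Q * V * HE τ a := by
    rw [← sub_eq_iff_eq_add']
    refine mul_SE_right_cancel hτ₀ ?_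
    rw [hQ, ← hV]
    simp only [mul_assoc]
  refine ⟨P.1, ⟨mul_mem_E₀ (vac_mem_E₀ (A' * SE τ a).2) (Sinv_spec hτ₀ a).1, (Q * V).1,
    (Q * V).2, congrArg Subtype.val hQ'⟩, ?_⟩
  rintro P' ⟨hP', Q', hQ'E, hA'⟩
  let P'' : RingE a := ⟨P', E₀_subset_E hP'⟩
  let Q'' : RingE a := ⟨Q', hQ'E⟩
  have h1 : A' = P'' + Q'' * HE τ a := Subtype.ext hA'
  have h2 : P'' - P = (Q * V - Q'') * HE τ a := by
    rw [sub_mul, sub_eq_sub_iff_add_eq_add, ← h1, hQ', add_comm]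
  have h3 : P'' - P = 0 := by
    refine eq_zero_of_mul_SE_mem hτ₀
      (sub_mem_E₀ hP' (mul_mem_E₀ (vac_mem_E₀ (A' * SE τ a).2) (Sinv_spec hτ₀ a).1)) ?_
    rw [h2, mul_assoc]
    exact (vacuumIdeal a).mul_mem_left _ hH
  exact congrArg Subtype.val (sub_eq_zero.1 h3)

/-- `π τ a A` is the projection of `A` along the left ideal generated by `H`. -/
theorem isProj_π (hτ₀ : ∀ m, τ m ≠ 0) {a : Fin 2} (hH : HE τ a * SE τ a ∈ vacuumIdeal a) {A : Op}
    (hA : A ∈ E a) : IsProj a (H τ) A (π τ a A) := by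
  have h := (existsUnique_isProj hτ₀ hH hA).exists
  unfold π proj
  rw [dif_pos h]
  exact h.choose_spec

/-- The Sato equation implies the Lax equation. -/
theorem deriv_L_eq (hτ₀ : ∀ m, τ m ≠ 0) {b : Fin 2} (hH : HE τ b * SE τ b ∈ vacuumIdeal b)
    (s : Time) (A N : RingE b) (hN₀ : N.1 ∈ E₀ b)
    (hN : N * lamE b (ax b (-1)) = LE hτ₀ b * N)
    (hA : A * SE τ b - (derivE s (SE τ b) + N) ∈ vacuumIdeal b) :
    Op.deriv s (L τ b) = comm (π τ b A.1) (L τ b) := by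
  obtain ⟨hP, Q, hQ, hAP⟩ := isProj_π hτ₀ hH A.2
  let M : RingE b := ⟨π τ b A.1, E₀_subset_E hP⟩
  let Q' : RingE b := ⟨Q, hQ⟩
  have hAM : A = M + Q' * HE τ b := Subtype.ext hAP
  -- Replacing `A` by its projection changes the congruence by a left multiple of `H S`. All terms
  -- now lie in `E₀ b`, so the congruence becomes an equality.
  have hMS : M * SE τ b - (derivE s (SE τ b) + N) = 0 := by
    refine eq_zero_of_mem_vacuumIdeal ?_ (sub_mem_E₀ (mul_mem_E₀ hP (S_mem_E₀ τ b))
      (add_mem_E₀ (deriv_mem_E₀ s (S_mem_E₀ τ b)) hN₀))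
    have h1 := (vacuumIdeal b).sub_mem hA ((vacuumIdeal b).mul_mem_left Q' hH)
    convert h1 using 1
    rw [hAM]
    noncomm_ring
  have hdS : derivE s (SE τ b) = M * SE τ b - N := by
    rw [eq_sub_iff_add_eq]
    exact (sub_eq_zero.1 hMS).symm
  -- The derivative of `L S = S Λ` is taken, with `Λ` the shift dressed into `L`. After substitution
  -- of `∂S = M S - N` the terms in `N` cancel by `hN`.
  have hd := congrArg (derivE s) (LE_mul_SE hτ₀ b)
  rw [derivE_mul, derivE_mul, derivE_lamE, mul_zero, add_zero, hdS] at hd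
  have hfin : derivE s (LE hτ₀ b) = M * LE hτ₀ b - LE hτ₀ b * M := by
    refine mul_SE_right_cancel hτ₀ ?_
    rw [sub_mul, mul_assoc M, LE_mul_SE]
    rw [sub_mul, hN, mul_sub] at hd
    rw [eq_sub_of_add_eq hd]
    noncomm_ring
  exact congrArg Subtype.val hfin

/-! ### Conjugation by `H` -/

theorem Δ₂star_mem_E₀ : Δ₂star ∈ E₀ 1 := sub_mem_E₀ (lam_mem_E₀ rfl) (lam_mem_E₀ rfl)

theorem Δ₂starInv_mem_E₀ : Δ₂starInv ∈ E₀ 1 := by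
  have hco : ∀ k : ℤ × ℤ, ¬(k.1 = 0 ∧ 1 ≤ k.2) → Δ₂starInv k = 0 := fun k hk =>
    funext fun m => if_neg hk
  refine mem_E₀_iff.2 ⟨mem_E_iff.2 fun N => ?_, fun k hk => hco k fun h => hk h.1⟩
  refine ((Set.finite_Icc 1 N).image (ax 1)).subset fun k hk => ?_
  have h : k.1 = 0 ∧ 1 ≤ k.2 := by
    by_contra h
    exact hk.2 (hco k h)
  exact ⟨deg 1 k, ⟨h.2, hk.1⟩, ax_deg h.1⟩

/-- `Δ₂^{*-1}` as an element of `E 1`. -/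
def starInvE : RingE 1 := ⟨Δ₂starInv, E₀_subset_E Δ₂starInv_mem_E₀⟩

/-- The sum telescopes; equivalently, `Λ₂ - 1 = -Δ₂^* Λ₂`. -/
theorem starInvE_mul : starInvE * (lamE 1 e₂ - 1) = -lamE 1 e₂ := by
  rw [mul_sub, mul_one]
  refine Subtype.ext (ext' fun k m => ?_)
  change (Δ₂starInv * lam e₂) k m - Δ₂starInv k m = -lam e₂ k m
  rw [mul_lam]
  obtain ⟨i, j⟩ := k
  simp only [Δ₂starInv, lam, e₂, Prod.fst_sub, Prod.snd_sub, Prod.mk.injEq, sub_zero]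
  rcases lt_trichotomy j 1 with h | h | h
  · rw [if_neg (by omega), if_neg (by omega), if_neg (by omega), sub_zero, neg_zero]
  · rw [if_neg (by omega), zero_sub]
    exact congrArg _ (if_congr (by omega) rfl rfl)
  · rw [if_neg (c := i = 0 ∧ j = 1) (by omega), neg_zero, sub_eq_zero]
    exact if_congr (by omega) rfl rfl

/-- The operator `Q` with `H X - Q H` free of the shift that acts trivially on the vacuum. -/
def conjH (a : Fin 2) (X : Op) : Op :=
  if a = 0 then shift e X else Δ₂star * shift e X * Δ₂starInv

theorem conjH_mem_E₀ {a : Fin 2} {X : Op} (hX : X ∈ E₀ a) : conjH a X ∈ E₀ a := by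
  fin_cases a
  · exact shift_mem_E₀ e hX
  · exact mul_mem_E₀ (mul_mem_E₀ Δ₂star_mem_E₀ (shift_mem_E₀ e hX)) Δ₂starInv_mem_E₀

/-- For `a = 0` the terms in `Λ₁ Λ₂` cancel. For `a = 1` the cancelling terms are those in `Λ₁`: the
conjugation by `Δ₂^*` is made so that `conjH 1 X * (Λ₂ - 1) = X(m + e) Λ₂ - X(m + e₁)`. -/
theorem H_mul_sub_mem_E₀ {a : Fin 2} {X : Op} (hX : X ∈ E₀ a) :
    H τ * X - conjH a X * H τ ∈ E₀ a := by
  have he : e = e₁ + e₂ := rfl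
  obtain rfl | rfl : a = 0 ∨ a = 1 := by fin_cases a <;> simp
  · let X' : RingE 0 := ⟨X, E₀_subset_E hX⟩
    have h : HE τ 0 * X' - shiftE e X' * HE τ 0 =
        shiftE e X' * lamE 0 e₁ - shiftE e₁ X' * lamE 0 e₁ +
          (fnE 0 (ρ τ) * X' - shiftE e X' * fnE 0 (ρ τ)) := by
      rw [HE_eq, add_mul, sub_mul, lamE_mul_lamE, lamE_mul, lamE_mul, he]
      noncomm_ring
    have h' := congrArg Subtype.val h
    change H τ * X - shift e X * H τ ∈ E₀ 0
    change H τ * X - shift e X * H τ = _ at h'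
    rw [h']
    exact add_mem_E₀ (sub_mem_E₀ (mul_mem_E₀ (shift_mem_E₀ _ hX) (lam_mem_E₀ rfl))
      (mul_mem_E₀ (shift_mem_E₀ _ hX) (lam_mem_E₀ rfl)))
      (sub_mem_E₀ (mul_mem_E₀ (fn_mem_E₀ _ _) hX)
        (mul_mem_E₀ (shift_mem_E₀ _ hX) (fn_mem_E₀ _ _)))
  · let X' : RingE 1 := ⟨X, E₀_subset_E hX⟩
    have h0 : (lamE 1 (-e₂) - 1) * shiftE e X' * starInvE * (lamE 1 e₁ * lamE 1 e₂ - lamE 1 e₁) =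
        shiftE e X' * (lamE 1 e₁ * lamE 1 e₂) - shiftE e₁ X' * lamE 1 e₁ := by
      have h1 : lamE 1 e₁ * lamE 1 e₂ - lamE 1 e₁ = (lamE 1 e₂ - 1) * lamE 1 e₁ := by
        rw [sub_mul, one_mul, lamE_mul_lamE, lamE_mul_lamE, add_comm]
      have h2 : lamE 1 (-e₂) * shiftE e X' = shiftE e₁ X' * lamE 1 (-e₂) := by
        rw [lamE_mul]
        congr 1
        exact Subtype.ext (shift_shift (-e₂) e X)
      rw [h1, mul_assoc _ starInvE, ← mul_assoc starInvE, starInvE_mul, neg_mul, mul_neg,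
        sub_mul, one_mul, h2, sub_mul, mul_assoc (shiftE e₁ X'), ← mul_assoc (lamE 1 (-e₂)),
        lamE_mul_lamE, neg_add_cancel, lamE_zero, one_mul, lamE_mul_lamE, lamE_mul_lamE,
        add_comm e₂, neg_sub]
    have h : HE τ 1 * X' - (lamE 1 (-e₂) - 1) * shiftE e X' * starInvE * HE τ 1 =
        fnE 1 (ρ τ) * X' - (lamE 1 (-e₂) - 1) * shiftE e X' * starInvE * fnE 1 (ρ τ) := by
      rw [HE_eq, add_mul, mul_add, h0, sub_mul, lamE_mul_lamE, lamE_mul, lamE_mul, he]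
      abel
    have h' := congrArg Subtype.val h
    change H τ * X - Δ₂star * shift e X * Δ₂starInv * H τ ∈ E₀ 1
    change H τ * X - Δ₂star * shift e X * Δ₂starInv * H τ = _ at h'
    rw [h']
    exact sub_mem_E₀ (mul_mem_E₀ (fn_mem_E₀ _ _) hX)
      (mul_mem_E₀ (conjH_mem_E₀ (a := 1) hX) (fn_mem_E₀ _ _))

/-- The difference of the two sides lies in `E₀ a` by the choice of `conjH`. It annihilates the wave
function, since `L` acts there as a pure shift on the right of `S`, which preserves the vacuum
ideal. -/
theorem H_mul_L (hτ₀ : ∀ m, τ m ≠ 0) {a : Fin 2} (hH : HE τ a * SE τ a ∈ vacuumIdeal a) :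
    H τ * L τ a = conjH a (L τ a) * H τ := by
  have hL := L_mem_E₀ hτ₀ a
  let C' : RingE a := ⟨conjH a (L τ a), E₀_subset_E (conjH_mem_E₀ hL)⟩
  have h : HE τ a * LE hτ₀ a - C' * HE τ a = 0 := by
    refine eq_zero_of_mul_SE_mem hτ₀ (H_mul_sub_mem_E₀ hL) ?_
    rw [sub_mul, mul_assoc, LE_mul_SE, ← mul_assoc, mul_assoc C']
    exact (vacuumIdeal a).sub_mem (mul_lamE_mem_vacuumIdeal hH _)
      ((vacuumIdeal a).mul_mem_left _ hH)
  exact congrArg Subtype.val (sub_eq_zero.1 h)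

theorem deriv_fn (s : Time) (f : ℤ × ℤ → TimeField) :
    Op.deriv s (fn f) = fn fun m => fracDeriv s (f m) := ext' fun k m => by
  change fracDeriv s (if k = 0 then f m else 0) = if k = 0 then fracDeriv s (f m) else 0
  split_ifs
  · rfl
  · exact fracDeriv_zero s

theorem deriv_H (s : Time) : Op.deriv s (H τ) = fn fun m => fracDeriv s (ρ τ m) := by
  have h : Op.deriv s (lam e₁ * Δ₂) = 0 := by
    refine ext' fun k m => ?_
    rw [deriv_apply, lam_mul]
    change fracDeriv s ((if k - e₁ = e₂ then 1 else 0) - (if k - e₁ = 0 then 1 else 0)) = 0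
    have h1 := map_sub (fracDerivHom s)
    simp only [fracDerivHom_apply] at h1
    rw [h1]
    split_ifs <;> simp
  rw [H, deriv_add, deriv_fn, h, zero_add]

/-- Differentiating the fact that `H S` annihilates the vacuum, and inserting the evolution of `S`,
shows that `∂H + H X - conjH a X * H` annihilates the wave function. It lies in `E₀ a`, since only
`ρ` in `H` depends on the times. -/
theorem deriv_H_eq (hτ₀ : ∀ m, τ m ≠ 0) {a : Fin 2} (hH : HE τ a * SE τ a ∈ vacuumIdeal a)
    (s : Time) (v : ℤ × ℤ) {X : Op} (hX : X ∈ E₀ a)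
    (hXS : (⟨X, E₀_subset_E hX⟩ : RingE a) * SE τ a -
      (derivE s (SE τ a) + SE τ a * lamE a v) ∈ vacuumIdeal a) :
    Op.deriv s (H τ) = conjH a X * H τ - H τ * X := by
  let X' : RingE a := ⟨X, E₀_subset_E hX⟩
  let C' : RingE a := ⟨conjH a X, E₀_subset_E (conjH_mem_E₀ hX)⟩
  have h : derivE s (HE τ a) + (HE τ a * X' - C' * HE τ a) = 0 := by
    refine eq_zero_of_mul_SE_mem hτ₀ (add_mem_E₀ ?_ (H_mul_sub_mem_E₀ hX)) ?_
    · change Op.deriv s (H τ) ∈ E₀ a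
      rw [deriv_H]
      exact fn_mem_E₀ _ _
    · have h1 := derivE_mem_vacuumIdeal hH s
      rw [derivE_mul] at h1
      have h2 := (vacuumIdeal a).mul_mem_left (HE τ a) hXS
      have h3 := mul_lamE_mem_vacuumIdeal hH v
      have h4 := (vacuumIdeal a).mul_mem_left C' hH
      convert (vacuumIdeal a).sub_mem ((vacuumIdeal a).add_mem ((vacuumIdeal a).add_mem h1 h2) h3)
        h4 using 1
      noncomm_ring
  have h' : derivE s (HE τ a) = C' * HE τ a - HE τ a * X' := by
    rw [eq_neg_of_add_eq_zero_left h, neg_sub]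
  exact congrArg Subtype.val h'

end Operators

open Op

namespace Op

/-! ## The truncations that define `B` -/

/-- These are the properties of the truncation used on wave functions: finitely many nonnegative
powers of `Λ₁`, and a remainder that starts with `Λ₁⁻¹`, of degree `1`. -/
theorem nonneg₁_spec {A : Op} (hA : A ∈ E₀ 0) : ∃ F : Finset (ℤ × ℤ),
    (∀ v ∈ F, v.2 = 0 ∧ 0 ≤ v.1) ∧ (∀ v ∉ F, nonneg₁ A v = 0) ∧
      ∀ k, deg 0 k < 1 → (A - nonneg₁ A) k = 0 := by
  have hfin : {k : ℤ × ℤ | 0 ≤ k.1 ∧ A k ≠ 0}.Finite :=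
    (mem_E_iff.1 (E₀_subset_E hA) 0).subset fun k hk => ⟨neg_nonpos.2 hk.1, hk.2⟩
  refine ⟨hfin.toFinset, fun v hv => ?_, fun v hv => ?_, fun k hk => ?_⟩
  · rw [Set.Finite.mem_toFinset] at hv
    refine ⟨?_, hv.1⟩
    by_contra h
    exact hv.2 ((mem_E₀_iff.1 hA).2 v h)
  · rw [Set.Finite.mem_toFinset] at hv
    funext m
    change (if 0 ≤ v.1 then A v m else 0) = 0
    split_ifs with h
    · rw [show A v = 0 from by by_contra h'; exact hv ⟨h, h'⟩]
      rfl
    · rfl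
  · have hk' : 0 ≤ k.1 := by
      have : -k.1 < 1 := hk
      omega
    funext m
    change A k m - (if 0 ≤ k.1 then A k m else 0) = 0
    rw [if_pos hk', sub_self]

/-- The operator `Λ₂⁻¹` plays the role of the polynomial variable. -/
theorem npow_Δ₂star_apply (n : ℕ) (k m : ℤ × ℤ) :
    npow Δ₂star n k m = if k.1 = 0 ∧ k.2 ≤ 0 then
      ((((Polynomial.X - 1 : Polynomial ℤ) ^ n).coeff (-k.2).toNat : ℤ) : TimeField) else 0 := by
  induction n generalizing k with
  | zero =>
    change (if k = 0 then 1 else 0) = _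
    rw [pow_zero, Polynomial.coeff_one]
    obtain ⟨i, j⟩ := k
    dsimp only
    by_cases h : i = 0 ∧ j ≤ 0
    · rw [if_pos h]
      by_cases hj : j = 0
      · rw [if_pos (by rw [h.1, hj]; rfl), if_pos (by omega), Int.cast_one]
      · rw [if_neg fun h' => hj (congrArg Prod.snd h'), if_neg (by omega), Int.cast_zero]
    · rw [if_neg h, if_neg]
      intro h'
      simp only [Prod.mk_eq_zero] at h'
      omega
  | succ n ih =>
    let T : RingE 1 := ⟨Δ₂star, E₀_subset_E Δ₂star_mem_E₀⟩
    have h : npow Δ₂star (n + 1) = npow Δ₂star n * lam (-e₂) - npow Δ₂star n := by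
      have h1 : T ^ (n + 1) = T ^ n * lamE 1 (-e₂) - T ^ n := by
        rw [pow_succ, show T = lamE 1 (-e₂) - 1 from rfl, mul_sub, mul_one]
      have h2 := congrArg Subtype.val h1
      rw [coe_pow] at h2
      refine h2.trans ?_
      change (T ^ n : RingE 1).1 * lam (-e₂) - (T ^ n : RingE 1).1 = _
      rw [coe_pow]
    rw [h, sub_apply, mul_lam, ih, ih, pow_succ, mul_sub, mul_one, Polynomial.coeff_sub]
    obtain ⟨i, j⟩ := k
    simp only [e₂, sub_neg_eq_add, Prod.mk_add_mk, add_zero]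
    by_cases h1 : i = 0 ∧ j + 1 ≤ 0
    · rw [if_pos h1, if_pos (by omega), if_pos (by omega),
        show (-j).toNat = (-(j + 1)).toNat + 1 by omega, Polynomial.coeff_mul_X, Int.cast_sub]
    · rw [if_neg h1]
      by_cases h2 : i = 0 ∧ j ≤ 0
      · rw [if_pos h2, if_pos h2, show (-j).toNat = 0 by omega, Polynomial.coeff_mul_X_zero]
        simp
      · rw [if_neg h2, if_neg h2, sub_zero]

theorem sum_choose_mul_X_sub_one_pow {n N : ℕ} (hn : n ≤ N) :
    ∑ j ∈ Finset.range N, (n.choose (j + 1) : Polynomial ℤ) * (Polynomial.X - 1) ^ (j + 1) =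
      Polynomial.X ^ n - 1 := by
  have h := add_pow (Polynomial.X - 1 : Polynomial ℤ) 1 n
  rw [sub_add_cancel] at h
  rw [h, Finset.sum_subset (Finset.range_mono (show n + 1 ≤ N + 1 by omega)) fun i _ hi => by
    rw [Nat.choose_eq_zero_of_lt (by simpa using hi), Nat.cast_zero, mul_zero],
    Finset.sum_range_succ']
  simp [mul_comm]

/-- The value of an operator at an exponent and a point, as an additive map. -/
def evalHom (k m : ℤ × ℤ) : Op →+ TimeField where
  toFun A := A k m
  map_zero' := rfl
  map_add' _ _ := rfl

/-- A positive power of `Δ₂^*` receives contributions only from negative powers of `Λ₂`, for which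
the generalized binomial coefficients are ordinary ones. -/
theorem starCoeff_eq {A : Op} {N : ℕ} (hN : ∀ n : ℕ, N < n → A (0, -n) = 0) (j : ℕ)
    (m : ℤ × ℤ) : starCoeff A (j + 1) m =
      ∑ n ∈ Finset.range (N + 1), (n.choose (j + 1) : TimeField) * A (0, -n) m := by
  have hterm : ∀ l : ℕ, ((Ring.choose ((j + 1 : ℤ) + l) l : ℤ) : TimeField) *
      A (0, -((j + 1 : ℤ) + l)) m =
        ((j + 1 + l).choose (j + 1) : TimeField) * A (0, -((j + 1 + l : ℕ) : ℤ)) m := by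
    intro l
    have h1 : ((j + 1 : ℤ) + l) = ((j + 1 + l : ℕ) : ℤ) := by push_cast; ring
    rw [h1, Ring.choose_natCast, Nat.choose_symm_add, Int.cast_natCast]
  unfold starCoeff
  rw [finsum_congr hterm]
  by_cases hj : N < j + 1
  · rw [finsum_eq_zero_of_forall_eq_zero fun l => ?_]
    · refine (Finset.sum_eq_zero fun n hn => ?_).symm
      rw [Nat.choose_eq_zero_of_lt (by have := Finset.mem_range.1 hn; omega), Nat.cast_zero,
        zero_mul]
    · rw [hN _ (by omega)]
      exact mul_zero _
  · rw [finsum_eq_sum_of_support_subset (s := Finset.range (N + 1 - (j + 1))) _ fun l hl => ?_]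
    · have hN' : N + 1 = (j + 1) + (N + 1 - (j + 1)) := by omega
      conv_rhs => rw [hN', Finset.sum_range_add]
      have h0 : ∑ n ∈ Finset.range (j + 1), (n.choose (j + 1) : TimeField) * A (0, -n) m = 0 :=
        Finset.sum_eq_zero fun n hn => by
          rw [Nat.choose_eq_zero_of_lt (Finset.mem_range.1 hn), Nat.cast_zero, zero_mul]
      rw [h0, zero_add]
    · rw [Finset.coe_range, Set.mem_Iio]
      by_contra h
      refine hl ?_
      change _ * A (0, -((j + 1 + l : ℕ) : ℤ)) m = 0
      rw [hN _ (by omega)]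
      exact mul_zero _

/-- For `n ≥ 0` the expansion of `Λ₂ ^ (-n) = (Δ₂^* + 1) ^ n` has constant term `1`, so its part
with positive powers of `Δ₂^*` is `Λ₂ ^ (-n) - 1`. -/
theorem starPos_apply {A : Op} {N : ℕ} (hN : ∀ n : ℕ, N < n → A (0, -n) = 0) (k m : ℤ × ℤ) :
    starPos A k m = if k.1 = 0 ∧ k.2 ≤ 0 then ∑ n ∈ Finset.range (N + 1), A (0, -n) m *
      (((Polynomial.X ^ n - 1 : Polynomial ℤ).coeff (-k.2).toNat : ℤ) : TimeField) else 0 := by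
  have h1 : starPos A = ∑ j ∈ Finset.range N,
      smulFn (starCoeff A ((j : ℤ) + 1)) (npow Δ₂star (j + 1)) := by
    refine finsum_eq_sum_of_support_subset _ fun j hj => ?_
    rw [Finset.coe_range, Set.mem_Iio]
    by_contra h
    refine hj (ext' fun k m => ?_)
    change starCoeff A (j + 1) m * _ = 0
    rw [starCoeff_eq hN, Finset.sum_eq_zero fun n hn => ?_, zero_mul]
    rw [Nat.choose_eq_zero_of_lt (by have := Finset.mem_range.1 hn; omega), Nat.cast_zero,
      zero_mul]
  have h2 : starPos A k m = ∑ j ∈ Finset.range N,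
      starCoeff A ((j : ℤ) + 1) m * npow Δ₂star (j + 1) k m := by
    rw [h1]
    exact map_sum (evalHom k m) (fun j : ℕ =>
      smulFn (starCoeff A ((j : ℤ) + 1)) (npow Δ₂star (j + 1))) (Finset.range N)
  rw [h2]
  simp only [npow_Δ₂star_apply]
  split_ifs with hk
  · simp only [starCoeff_eq hN, Finset.sum_mul]
    rw [Finset.sum_comm]
    refine Finset.sum_congr rfl fun n hn => ?_
    rw [← sum_choose_mul_X_sub_one_pow (Nat.lt_succ_iff.1 (Finset.mem_range.1 hn)),
      Polynomial.finsetSum_coeff, Int.cast_sum, Finset.mul_sum]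
    refine Finset.sum_congr rfl fun j _ => ?_
    rw [← Polynomial.C_eq_natCast, Polynomial.coeff_C_mul, Int.cast_mul]
    push_cast
    ring
  · simp

/-- The truncation keeps the negative powers of `Λ₂` and adds the multiple of `1` that makes it
annihilate constants. The first fact controls its order on the second wave function, the other on
the first. -/
theorem starPos_spec {A : Op} (hA : A ∈ E₀ 1) : ∃ F : Finset (ℤ × ℤ),
    (∀ v ∈ F, v.1 = 0 ∧ v.2 ≤ 0) ∧ (∀ v ∉ F, starPos A v = 0) ∧
      (∀ m, ∑ v ∈ F, starPos A v m = 0) ∧ ∀ k, deg 1 k < 0 → (A - starPos A) k = 0 := by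
  obtain ⟨M, hM⟩ := exists_deg_bound (E₀_subset_E hA)
  obtain ⟨N, hN⟩ : ∃ N : ℕ, ∀ n : ℕ, N < n → A (0, -n) = 0 := by
    refine ⟨(-M).toNat, fun n hn => ?_⟩
    by_contra h
    have : M ≤ -(n : ℤ) := hM _ h
    omega
  have hlow : ∀ k : ℤ × ℤ, k.1 = 0 → k.2 < 0 → starPos A k = A k := by
    rintro ⟨i, j⟩ (rfl : i = 0) (hj : j < 0)
    obtain ⟨n, rfl⟩ : ∃ n : ℕ, j = -n := ⟨(-j).toNat, by omega⟩
    have hn : n ≠ 0 := by omega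
    funext m
    rw [starPos_apply hN, if_pos ⟨rfl, hj.le⟩]
    simp only [neg_neg, Int.toNat_natCast, Polynomial.coeff_sub, Polynomial.coeff_X_pow,
      Polynomial.coeff_one, hn, if_false, sub_zero, Int.cast_ite, Int.cast_one, Int.cast_zero,
      mul_ite, mul_one, mul_zero, Finset.sum_ite_eq, Finset.mem_range]
    split_ifs with h
    · rfl
    · rw [hN n (by omega)]
      rfl
  have hinj : Function.Injective fun n : ℕ => ((0, -n) : ℤ × ℤ) := fun n n' h => by
    simpa using h
  refine ⟨(Finset.range (N + 1)).map ⟨_, hinj⟩, fun v hv => ?_, fun v hv => ?_, fun m => ?_,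
    fun k hk => ?_⟩
  · obtain ⟨n, -, rfl⟩ := Finset.mem_map.1 hv
    exact ⟨rfl, by simp⟩
  · by_cases h : v.1 = 0 ∧ v.2 ≤ 0
    · obtain ⟨i, j⟩ := v
      obtain ⟨rfl : i = 0, hj : j ≤ 0⟩ := h
      obtain ⟨n, rfl⟩ : ∃ n : ℕ, j = -n := ⟨(-j).toNat, by omega⟩
      have hn : N < n := by
        by_contra hn
        exact hv (Finset.mem_map.2 ⟨n, Finset.mem_range.2 (by omega), rfl⟩)
      rw [hlow _ rfl (by dsimp only; omega), hN n hn]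
    · funext m
      rw [starPos_apply hN, if_neg h]
      rfl
  · rw [Finset.sum_map, Finset.sum_range_succ']
    change ∑ n ∈ Finset.range N, starPos A (0, -((n + 1 : ℕ) : ℤ)) m +
      starPos A (0, -((0 : ℕ) : ℤ)) m = 0
    rw [starPos_apply hN, if_pos (by simp), Finset.sum_range_succ',
      Finset.sum_congr rfl fun n _ => congrFun (hlow (0, -((n + 1 : ℕ) : ℤ)) rfl
        (by dsimp only; omega)) m]
    simp [Polynomial.coeff_X_pow]
  · by_cases h : k.1 = 0
    · funext m
      change A k m - starPos A k m = 0
      rw [hlow k h hk, sub_self]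
    · funext m
      change A k m - starPos A k m = 0
      rw [starPos_apply hN, if_neg fun h' => h h'.1, sub_zero, (mem_E₀_iff.1 hA).2 k h]
      rfl

end Op

open Op

/-! ## The linear equations for the wave functions -/

section Linear

variable {τ : ℤ × ℤ → TimeSeries}

/-- The action of an operator with exponents in a finite set on a wave function. -/
def opWave (τ : ℤ × ℤ → TimeSeries) (F : Finset (ℤ × ℤ)) (P : Op) (b : Fin 2) (m : ℤ × ℤ) :
    LaurentSeries TimeField :=
  ∑ v ∈ F, HahnSeries.single (deg b v) (P v m) * wave τ b (m + v)

theorem coeff_single_mul' {K : Type} [Field K] (b n : ℤ) (r : K) (x : LaurentSeries K) :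
    (HahnSeries.single b r * x).coeff n = r * x.coeff (n - b) := by
  have h := HahnSeries.coeff_single_mul_add (r := r) (x := x) (a := n - b) (b := b)
  rwa [sub_add_cancel] at h

theorem coeff_opWave (F : Finset (ℤ × ℤ)) (P : Op) (b : Fin 2) (m : ℤ × ℤ) (n : ℤ) :
    (opWave τ F P b m).coeff n = ∑ v ∈ F, P v m * (wave τ b (m + v)).coeff (n - deg b v) := by
  rw [opWave, HahnSeries.coeff_sum]
  exact Finset.sum_congr rfl fun v _ => coeff_single_mul' _ _ _ _

theorem mem_E_of_finset (b : Fin 2) {F : Finset (ℤ × ℤ)} {P : Op} (hF : ∀ v ∉ F, P v = 0) :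
    P ∈ E b :=
  mem_E_of_finite b (F.finite_toSet.subset fun v hv => by
    by_contra h
    exact hv (hF v h))

/-- This is the dictionary between operators modulo the vacuum ideal and linear equations for wave
functions. -/
theorem lineSum_mul_S {F : Finset (ℤ × ℤ)} {P : Op} (hF : ∀ v ∉ F, P v = 0) (b : Fin 2)
    (k m : ℤ × ℤ) : lineSum b (P * S τ b) k m = (opWave τ F P b m).coeff (deg b k) := by
  rw [lineSum_mul (mem_E_of_finset b hF) (E₀_subset_E (S_mem_E₀ τ b)), coeff_opWave,
    finsum_eq_sum_of_support_subset (s := F) _ fun v hv => ?_]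
  · refine Finset.sum_congr rfl fun v _ => ?_
    rw [lineSum_S, deg_sub]
  · by_contra h
    refine hv ?_
    change P v m * _ = 0
    rw [hF v h]
    exact zero_mul _

/-- The pairing identity is linear over functions of `m`, and the shift `m ↦ m + v` stays in its
domain when `v₂ ≤ v₁`. The degrees of the monomials account for the stripped powers of `z`. -/
theorem opWave_pairing (hτ : IsTau τ) {F : Finset (ℤ × ℤ)} (P : Op) (hF : ∀ v ∈ F, v.2 ≤ v.1)
    {m m' : ℤ × ℤ} (h : m'.1 - m'.2 ≤ m.1 - m.2) :
    (opWave τ F P 0 m * dualWave τ 0 m').coeff (m.1 - m'.1 + 1) =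
      (opWave τ F P 1 m * dualWave τ 1 m').coeff (-(m.2 - m'.2) - 1) := by
  rw [opWave, opWave, Finset.sum_mul, Finset.sum_mul, HahnSeries.coeff_sum, HahnSeries.coeff_sum]
  refine Finset.sum_congr rfl fun v hv => ?_
  rw [mul_assoc, mul_assoc, coeff_single_mul', coeff_single_mul']
  have hv' := hF v hv
  have h1 := hτ.coeff_wave_mul (m := m + v) (m' := m')
    (by rw [Prod.fst_add, Prod.snd_add]; omega)
  rw [Prod.fst_add, Prod.snd_add] at h1
  have e1 : m.1 - m'.1 + 1 - deg 0 v = m.1 + v.1 - m'.1 + 1 := by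
    change m.1 - m'.1 + 1 - -v.1 = _
    ring
  have e2 : -(m.2 - m'.2) - 1 - deg 1 v = -(m.2 + v.2 - m'.2) - 1 := by
    change -(m.2 - m'.2) - 1 - v.2 = _
    ring
  rw [e1, e2, h1]

/-- `H` annihilates the wave functions. -/
theorem HE_mul_SE_mem (hτ₀ : ∀ m, τ m ≠ 0) (hτ : IsTau τ) (a : Fin 2) :
    HE τ a * SE τ a ∈ vacuumIdeal a := by
  have hne := fun m => algebraMap_time_ne_zero (hτ₀ m)
  have hHv : ∀ k m, H τ k m = (if k = e then 1 else 0) - (if k = e₁ then 1 else 0) +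
      (if k = 0 then ρ τ m else 0) := by
    intro k m
    have h := congrArg (fun A : RingE 0 => A.1 k m) (HE_eq τ 0)
    rw [lamE_mul_lamE] at h
    exact h
  let F : Finset (ℤ × ℤ) := {e, e₁, 0}
  have hF : ∀ v ∉ F, H τ v = 0 := by
    intro v hv
    simp only [F, Finset.mem_insert, Finset.mem_singleton, not_or] at hv
    funext m
    rw [hHv, if_neg hv.1, if_neg hv.2.1, if_neg hv.2.2]
    simp
  have hsum : ∀ b m n, (opWave τ F (H τ) b m).coeff n =
      (wave τ b (m + e)).coeff (n - deg b e) - (wave τ b (m + e₁)).coeff (n - deg b e₁) +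
        ρ τ m * (wave τ b m).coeff n := by
    intro b m n
    have h1 : e ∉ ({e₁, 0} : Finset (ℤ × ℤ)) := by decide
    have h2 : e₁ ∉ ({0} : Finset (ℤ × ℤ)) := by decide
    have h3 : e ≠ e₁ := by decide
    have h4 : e ≠ 0 := by decide
    have h5 : e₁ ≠ 0 := by decide
    rw [coeff_opWave, Finset.sum_insert h1, Finset.sum_insert h2, Finset.sum_singleton,
      hHv, hHv, hHv]
    simp [h3, h4, h5, h3.symm, h4.symm, h5.symm, deg_zero]
    ring
  -- The value `c = 1` requires order at least `0` in the first component and at least `1` in the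
  -- second.
  have hzero := fun m => eq_zero_of_pairing hτ₀ m 1 (opWave τ F (H τ) 0 m)
    (opWave τ F (H τ) 1 m) (fun n hn => by
      rw [hsum]
      change (wave τ 0 (m + e)).coeff (n - -1) - (wave τ 0 (m + e₁)).coeff (n - -1) + _ = 0
      rw [coeff_wave_of_neg 0 m (by omega), mul_zero, add_zero]
      rcases eq_or_ne n (-1) with rfl | hn'
      -- `Λ₁` creates a pole, which the factor `Λ₂ - 1` cancels because the leading coefficient is
      -- `1` at every point.
      · rw [sub_self, coeff_wave_zero, coeff_wave_zero, numPoint_zero, numPoint_zero,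
          div_self (hne _), div_self (hne _), sub_self]
      · rw [coeff_wave_of_neg 0 _ (by omega), coeff_wave_of_neg 0 _ (by omega), sub_self])
    (fun n hn => by
      rw [hsum]
      change (wave τ 1 (m + e)).coeff (n - 1) - (wave τ 1 (m + e₁)).coeff (n - 0) + _ = 0
      rw [coeff_wave_of_neg 1 _ (by omega), zero_sub, sub_zero]
      rcases eq_or_ne n 0 with rfl | hn'
      -- The vanishing of this coefficient is what determines `ρ`.
      · rw [coeff_wave_zero, coeff_wave_zero, numPoint_one, numPoint_one, ρ,
          show m + e + e₁ = m + e₁ + e by abel]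
        have h1 := hne m
        have h2 := hne (m + e)
        have h3 := hne (m + e₁)
        field_simp
        ring
      · rw [coeff_wave_of_neg 1 _ (by omega), coeff_wave_of_neg 1 _ (by omega), neg_zero,
          mul_zero, add_zero])
    (fun m' h => opWave_pairing hτ (H τ) (by decide) h)
  intro k m
  refine (lineSum_mul_S hF a k m).trans ?_
  obtain rfl | rfl : a = 0 ∨ a = 1 := by fin_cases a <;> simp
  · rw [(hzero m).1, HahnSeries.coeff_zero]
  · rw [(hzero m).2, HahnSeries.coeff_zero]

/-- If the action of `P` on the wave functions agrees with that of the derivative with respect to a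
time up to terms of the right orders, then it agrees with it. -/
theorem opWave_eq (hτ₀ : ∀ m, τ m ≠ 0) (hτ : IsTau τ) (a : Fin 2) (n : ℕ+)
    {F : Finset (ℤ × ℤ)} {P : Op} (hF : ∀ v ∈ F, v.2 ≤ v.1)
    (hord : ∀ b m l, l < (if b = 0 then 1 else 0 : ℤ) → (opWave τ F P b m).coeff l =
      if a = b then (wave τ b m).coeff (l + n) else 0) (b : Fin 2) (m : ℤ × ℤ) :
    opWave τ F P b m = laurentDeriv (a, n) (wave τ b m) +
      if a = b then HahnSeries.single (-(n : ℤ)) 1 * wave τ b m else 0 := by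
  have hne := fun m => algebraMap_time_ne_zero (hτ₀ m)
  have hs : ∀ b l, (if a = b then HahnSeries.single (-(n : ℤ)) 1 * wave τ b m else 0).coeff l =
      if a = b then (wave τ b m).coeff (l + n) else 0 := by
    intro b l
    split_ifs
    · rw [coeff_single_mul', one_mul, sub_neg_eq_add]
    · rfl
  -- The first wave function has the constant leading coefficient `1`, so its derivative gains one
  -- order; that of the second need not.
  have hd : ∀ b l, l < (if b = 0 then 1 else 0 : ℤ) →
      (laurentDeriv (a, n) (wave τ b m)).coeff l = 0 := by
    intro b l hl
    rw [coeff_laurentDeriv]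
    rcases lt_or_ge l 0 with h | h
    · rw [coeff_wave_of_neg b m h, fracDeriv_zero]
    · obtain rfl : b = 0 := by
        by_contra hb
        rw [if_neg hb] at hl
        omega
      rw [if_pos rfl] at hl
      obtain rfl : l = 0 := by omega
      rw [coeff_wave_zero, numPoint_zero, div_self (hne m), fracDeriv_one]
  have hz : ∀ b l, l < (if b = 0 then 1 else 0 : ℤ) → (opWave τ F P b m -
      (laurentDeriv (a, n) (wave τ b m) +
        if a = b then HahnSeries.single (-(n : ℤ)) 1 * wave τ b m else 0)).coeff l = 0 := by
    intro b l hl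
    rw [HahnSeries.coeff_sub, HahnSeries.coeff_add, hs, hd b l hl, hord b m l hl, zero_add,
      sub_self]
  have key := eq_zero_of_pairing hτ₀ m 0 _ _ (fun l hl => hz 0 l (by simpa using hl))
    (fun l hl => hz 1 l (by simpa using hl)) fun m' h => by
      have h1 := opWave_pairing hτ P hF h
      have h2 := hτ.coeff_laurentDeriv_wave_mul hτ₀ a n h
      have h3 : ∀ b l, ((if a = b then HahnSeries.single (-(n : ℤ)) 1 * wave τ b m else 0) *
          dualWave τ b m').coeff l =
            if a = b then (wave τ b m * dualWave τ b m').coeff (l + n) else 0 := by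
        intro b l
        split_ifs
        · rw [mul_assoc, coeff_single_mul', one_mul, sub_neg_eq_add]
        · rw [zero_mul, HahnSeries.coeff_zero]
      rw [sub_mul, sub_mul, add_mul, add_mul, HahnSeries.coeff_sub, HahnSeries.coeff_sub,
        HahnSeries.coeff_add, HahnSeries.coeff_add, h3, h3, h1, h2]
  obtain rfl | rfl : b = 0 ∨ b = 1 := by fin_cases b <;> simp
  · exact sub_eq_zero.1 key.1
  · exact sub_eq_zero.1 key.2

theorem smul_ax_neg_one (a : Fin 2) (n : ℕ) : n • ax a (-1) = ax a (-n) := by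
  unfold ax
  split_ifs <;> simp

/-- The action of a truncation of `L ^ n` on the wave function differs from that of `L ^ n` by
terms of the order of the remainder. -/
theorem coeff_opWave_truncation (hτ₀ : ∀ m, τ m ≠ 0) (a : Fin 2) (n : ℕ) {F : Finset (ℤ × ℤ)}
    {P : Op} (hF : ∀ v ∉ F, P v = 0) (c : ℤ)
    (hc : ∀ k, deg a k < c → (npow (L τ a) n - P) k = 0) (m : ℤ × ℤ) {l : ℤ} (hl : l < c) :
    (opWave τ F P a m).coeff l = (wave τ a m).coeff (l + n) := by
  have hP := mem_E_of_finset a hF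
  have hL := npow_mem_E₀ (L_mem_E₀ hτ₀ a) n
  have hLS : npow (L τ a) n * S τ a = S τ a * lam (ax a (-n)) := by
    have h := congrArg Subtype.val (LE_pow_mul_SE hτ₀ a n)
    rw [lamE_pow, smul_ax_neg_one, coe_mul, coe_pow] at h
    exact h
  have h1 := lineSum_mul_S hF a (ax a l) m (τ := τ)
  rw [deg_ax] at h1
  let P' : RingE a := ⟨P, hP⟩
  let L' : RingE a := ⟨npow (L τ a) n, E₀_subset_E hL⟩
  have h2 : P * S τ a = npow (L τ a) n * S τ a - (npow (L τ a) n - P) * S τ a :=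
    congrArg Subtype.val
      (show P' * SE τ a = L' * SE τ a - (L' - P') * SE τ a by noncomm_ring)
  have hSE : S τ a ∈ E a := (SE τ a).2
  have hR : npow (L τ a) n - P ∈ E a := (L' - P').2
  -- The remainder starts in degree `c` and `S` in degree `0`, so their product contributes nothing
  -- below `c`.
  have h3 : lineSum a ((npow (L τ a) n - P) * S τ a) (ax a l) m = 0 := by
    rw [lineSum_mul hR hSE]
    refine finsum_eq_zero_of_forall_eq_zero fun i => ?_
    rcases lt_or_ge (deg a i) c with hi | hi
    · rw [hc i hi]
      exact zero_mul _
    · rw [lineSum_S, coeff_wave_of_neg a _ (by rw [deg_sub, deg_ax]; omega), mul_zero]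
  rw [← h1, h2, lineSum_sub (mul_mem_E (E₀_subset_E hL) hSE)
    (mul_mem_E hR hSE), h3, sub_zero, hLS, lineSum_mul_lam, lineSum_S, deg_sub,
    deg_ax, deg_ax, sub_neg_eq_add]

/-- The linear evolution equations of the wave functions. -/
theorem exists_B_spec (hτ₀ : ∀ m, τ m ≠ 0) (hτ : IsTau τ) (a : Fin 2) (n : ℕ+) :
    ∃ F : Finset (ℤ × ℤ), (∀ v ∉ F, B τ a n v = 0) ∧ (∀ v ∈ F, codeg a v = 0) ∧
      ∀ b m, opWave τ F (B τ a n) b m = laurentDeriv (a, n) (wave τ b m) +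
        if a = b then HahnSeries.single (-(n : ℤ)) 1 * wave τ b m else 0 := by
  obtain rfl | rfl : a = 0 ∨ a = 1 := by fin_cases a <;> simp
  · obtain ⟨F, hF, hF', hc⟩ := nonneg₁_spec (npow_mem_E₀ (L_mem_E₀ hτ₀ 0) n)
    refine ⟨F, hF', fun v hv => (hF v hv).1, opWave_eq hτ₀ hτ 0 n
      (fun v hv => by have := hF v hv; omega) fun b m l hl => ?_⟩
    obtain rfl | rfl : b = 0 ∨ b = 1 := by fin_cases b <;> simp
    · rw [if_pos rfl] at hl ⊢
      exact coeff_opWave_truncation hτ₀ 0 n hF' 1 hc m hl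
    · rw [if_neg (by simp)] at hl ⊢
      -- Powers of `Λ₁` have degree `0` on the second component, so no negative order arises.
      rw [coeff_opWave]
      refine Finset.sum_eq_zero fun v hv => ?_
      have : deg 1 v = 0 := (hF v hv).1
      rw [coeff_wave_of_neg 1 _ (by omega), mul_zero]
  · obtain ⟨F, hF, hF', hsum, hc⟩ := starPos_spec (npow_mem_E₀ (L_mem_E₀ hτ₀ 1) n)
    refine ⟨F, hF', fun v hv => (hF v hv).1, opWave_eq hτ₀ hτ 1 n
      (fun v hv => by have := hF v hv; omega) fun b m l hl => ?_⟩
    obtain rfl | rfl : b = 0 ∨ b = 1 := by fin_cases b <;> simp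
    · rw [if_pos rfl] at hl
      rw [if_neg (by simp), coeff_opWave]
      have hdeg : ∀ v ∈ F, deg 0 v = 0 := fun v hv => neg_eq_zero.2 (hF v hv).1
      rcases lt_or_ge l 0 with h | h
      · refine Finset.sum_eq_zero fun v hv => ?_
        rw [hdeg v hv, coeff_wave_of_neg 0 _ (by omega), mul_zero]
      · obtain rfl : l = 0 := by omega
        -- All leading coefficients are `1`, so the coefficient of order `0` is the sum of the
        -- coefficients of `B`, which is zero.
        rw [← hsum m]
        refine Finset.sum_congr rfl fun v hv => ?_
        rw [hdeg v hv, sub_zero, coeff_wave_zero, numPoint_zero,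
          div_self (algebraMap_time_ne_zero (hτ₀ _)), mul_one]
        rfl
    · rw [if_neg (by simp)] at hl
      rw [if_pos rfl]
      exact coeff_opWave_truncation hτ₀ 1 n hF' 0 hc m hl

theorem B_mem_E (hτ₀ : ∀ m, τ m ≠ 0) (hτ : IsTau τ) (a b : Fin 2) (n : ℕ+) : B τ a n ∈ E b := by
  obtain ⟨F, hF, -⟩ := exists_B_spec hτ₀ hτ a n
  exact mem_E_of_finset b hF

theorem B_mem_E₀ (hτ₀ : ∀ m, τ m ≠ 0) (hτ : IsTau τ) (a : Fin 2) (n : ℕ+) : B τ a n ∈ E₀ a := by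
  obtain ⟨F, hF, hF', -⟩ := exists_B_spec hτ₀ hτ a n
  exact mem_E₀_iff.2 ⟨mem_E_of_finset a hF, fun k hk => hF k fun h => hk (hF' k h)⟩

/-- The inhomogeneous term in the evolution of the wave operators. -/
def sourceE (τ : ℤ × ℤ → TimeSeries) (a b : Fin 2) (n : ℕ) : RingE b :=
  if a = b then SE τ b * lamE b (ax b (-n)) else 0

/-- This is the Sato equation modulo the vacuum ideal, read off from the linear equation for the
wave function. -/
theorem B_mul_SE_sub_mem (hτ₀ : ∀ m, τ m ≠ 0) (hτ : IsTau τ) (a b : Fin 2) (n : ℕ+) :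
    (⟨B τ a n, B_mem_E hτ₀ hτ a b n⟩ : RingE b) * SE τ b -
      (derivE (a, n) (SE τ b) + sourceE τ a b n) ∈ vacuumIdeal b := by
  obtain ⟨F, hF, -, h⟩ := exists_B_spec hτ₀ hτ a n
  intro k m
  have h1 : lineSum b (sourceE τ a b n).1 k m =
      (if a = b then HahnSeries.single (-(n : ℤ)) 1 * wave τ b m else 0).coeff (deg b k) := by
    unfold sourceE
    split_ifs
    · refine (lineSum_mul_lam b (S τ b) _ k m).trans ?_
      rw [lineSum_S, deg_sub, deg_ax, coeff_single_mul', one_mul]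
    · exact finsum_zero
  refine (lineSum_sub (mul_mem_E (B_mem_E hτ₀ hτ a b n) (SE τ b).2)
    (derivE (a, n) (SE τ b) + sourceE τ a b n).2 k m).trans ?_
  rw [sub_eq_zero]
  refine Eq.trans (lineSum_mul_S hF b k m) (Eq.trans ?_
    (lineSum_add (derivE (a, n) (SE τ b)).2 (sourceE τ a b n).2 k m).symm)
  have h2 : lineSum b (derivE (a, n) (SE τ b)).1 k m =
      fracDeriv (a, n) ((wave τ b m).coeff (deg b k)) :=
    (lineSum_deriv _ (SE τ b).2 k m).trans (congrArg _ (lineSum_S τ b k m))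
  rw [h, HahnSeries.coeff_add, h1, h2, coeff_laurentDeriv]

/-- The source is `S` times a power of the shift that is dressed into `L`, and powers of one shift
commute. -/
theorem sourceE_mul (hτ₀ : ∀ m, τ m ≠ 0) (a b : Fin 2) (n : ℕ) :
    sourceE τ a b n * lamE b (ax b (-1)) = LE hτ₀ b * sourceE τ a b n := by
  unfold sourceE
  split_ifs
  · rw [← mul_assoc, LE_mul_SE, mul_assoc, mul_assoc, lamE_mul_lamE, lamE_mul_lamE, add_comm]
  · rw [zero_mul, mul_zero]

theorem sourceE_mem_E₀ (a b : Fin 2) (n : ℕ) : (sourceE τ a b n).1 ∈ E₀ b := by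
  unfold sourceE
  split_ifs
  · exact mul_mem_E₀ (S_mem_E₀ τ b) (lam_mem_E₀ (codeg_ax b _))
  · exact mem_E₀_iff.2 ⟨(0 : RingE b).2, fun _ _ => rfl⟩

theorem C_eq (a : Fin 2) (n : ℕ+) : C τ a n = conjH a (B τ a n) := by
  fin_cases a <;> rfl

end Linear

end TwoDKP

end
-- Assembly of the four assertions
open TwoDKP TwoDKP.Op in
theorem mainTheorem1 (τ : ℤ × ℤ → TimeSeries) (hτ₀ : ∀ m, τ m ≠ 0) (hτ : IsTau τ) :
    (∀ a : Fin 2, Sinv τ a ∈ E₀ a ∧ S τ a * Sinv τ a = 1 ∧ Sinv τ a * S τ a = 1) ∧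
    (∀ b : Fin 2, ∀ A ∈ E b, ∃! P : Op, IsProj b (H τ) A P) ∧
    (∀ (a b : Fin 2) (k : ℕ+), B τ a k ∈ E b ∧
      Op.deriv (a, k) (L τ b) = comm (π τ b (B τ a k)) (L τ b)) ∧
    H τ * L τ 0 = shift e (L τ 0) * H τ ∧
    H τ * L τ 1 = Δ₂star * shift e (L τ 1) * Δ₂starInv * H τ ∧
    (∀ (a : Fin 2) (k : ℕ+),
      Op.deriv (a, k) (H τ) = C τ a k * H τ - H τ * B τ a k) := by
  have hH := HE_mul_SE_mem hτ₀ hτ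
  refine ⟨Sinv_spec hτ₀, fun b A hA => existsUnique_isProj hτ₀ (hH b) hA, fun a b k =>
    ⟨B_mem_E hτ₀ hτ a b k, deriv_L_eq hτ₀ (hH b) (a, k) _ _ (sourceE_mem_E₀ a b k)
      (sourceE_mul hτ₀ a b k) (B_mul_SE_sub_mem hτ₀ hτ a b k)⟩, H_mul_L hτ₀ (hH 0),
    H_mul_L hτ₀ (hH 1), fun a k => ?_⟩
  rw [C_eq]
  -- The exponent is that of the source term `S_a Λ₁ ^ k` or `S_a Λ₂ ^ (-k)`, according to the
  -- component.
  refine deriv_H_eq hτ₀ (hH a) (a, k) (ax a (-(k : ℕ))) (B_mem_E₀ hτ₀ hτ a k) ?_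
  have h := B_mul_SE_sub_mem hτ₀ hτ a a k
  rwa [sourceE, if_pos rfl] at h
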